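/- **Conventions.** Let $J\subseteq\mathbb N^n$ be an M-convex set of rank $r$ on $[n]=\{1,\dots,n\}$, i.e. a nonempty set of vectors with coordinate sum $r$ such that for all $\alpha,\beta\in J$ and $i$ with $\alpha_i<\beta_i$ there is a $j$ with $\alpha_j>\beta_j$ and $\alpha+\varepsilon_i-\varepsilon_j,\ \beta-\varepsilon_i+\varepsilon_j\in J$. Let $\delta^-$ and $\delta^+$ be the coordinatewise minimum and maximum of $J$, and put $\omega=\delta^+-\delta^-$, $\bar J=J-\delta^-$ and $\bar r=r-\sum_i\delta^-_i$. For a tuple $a$ in $[n]$ put $\Sigma a=\sum_k\varepsilon_{a_k}$. The set $J$ is *indecomposable* if $n\ge 1$ and $J$ is not, up to a permutation of $[n]$, the direct sum (product) of two M-convex sets on nonempty ground sets. A *decomposition* of $J$ is a partition of $[n]$ into nonempty blocks such that $J$ is the direct sum of indecomposable M-convex sets whose ground sets are the blocks; $c(J)$ denotes the number of blocks. A *tract* is a commutative monoid with zero $F$ such that $F^\times=F\setminus\{0\}$ is a group, together with an ideal $N_F$ of the group semiring $\mathbb N[F^\times]$ (the null set) and an element $-1\in F^\times$ such that, for $a,b\in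 F$, one has $a+b\in N_F$ if and only if $b=(-1)a$. Morphisms are multiplicative maps that preserve $0$, $1$ and the null sets. A tract is *idempotent* if $1+1$ and $1+1+1$ are in $N_F$. A *weak $F$-representation* of $J$ is a map $\rho\colon[n]^{\bar r}\to F$ such that (i) $\rho(a)\neq0$ if and only if $\Sigma a\in\bar J$, (ii) $\rho(a\circ\sigma)=\mathrm{sign}(\sigma)\rho(a)$ for all permutations $\sigma$ of the entries, and (iii) $\rho(aij)\rho(akl)-\rho(aik)\rho(ajl)+\rho(ail)\rho(ajk)\in N_F$ for all $a\in[n]^{\bar r-2}$ and $i,j,k,l\in[n]$ with $\Sigma aijkl\le\omega$. The group $F^\times\times T(F)$, with $T(F)=(F^\times)^n$, acts on the weak representations by $((s,t).\rho)(a)=s\prod_kt_{a_k}\rho(a)$. The *weak thin Schubert cell* $\mathrm{Gr}^w_J(F)$ is the quotient of the set of weak representations by $F^\times$, with its induced $T(F)$-action, and the *realization space* $\underline{\mathrm{Gr}}^w_J(F)$ is the quotient by $F^\times\times T(F)$. If $F$ is idempotent, $\chi_{J,F}$ denotes the representation with value $1$ on all $a$ with $\Sigma a\in\bar J$ and $0$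 elsewhere, and the *lineality space* (of the thin Schubert cell) is $\mathrm{Lin}_J(F)=T(F).[\chi_{J,F}]\subseteq\mathrm{Gr}^w_J(F)$, a group under pointwise multiplication on $\{a:\Sigma a\in\bar J\}$. For a tract $k$, the *free algebra* $k(x_i\mid i\in I)$ is the tract with unit group $k^\times\times\bigoplus_I\mathbb Z$, the elements being Laurent monomials in the $x_i$ with coefficients in $k$, and with null set generated by that of $k$. Let $\mathbb F_1^\pm=\{0,1,-1\}$ be the tract whose null set is generated by $1+(-1)$. The *extended universal pasture* $\widehat P_J$ is the quotient of $\mathbb F_1^\pm(x_a\mid a\in[n]^{\bar r},\ \Sigma a\in\bar J)$ by the relations $x_{a\circ\sigma}=\mathrm{sign}(\sigma)x_a$ and $x_{aij}x_{akl}-x_{aik}x_{ajl}+x_{ail}x_{ajk}$ for $\Sigma aijkl\le\omega$, where $x_a=0$ if $\Sigma a\notin\bar J$. The *universal pasture* $P_J$ is the subtract of $\widehat P_J$ of elements of degree $0$, where $\deg x_a=1$, and the *foundation* $F_J\subseteq P_J$ is the subtract of those elements of $P_J$ that also have degree $0$ in the $\mathbb Z^n$-grading with $\deg_{[n]}x_a=\Sigma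 a$. (Subtracts carry the null set of all formal sums of their elements that are null in $\widehat P_J$.) **Theorem.** Let $J$ be an M-convex set of rank $r$ on $[n]$. 1. $J$ has a decomposition, and all decompositions of $J$ have the same number $c(J)$ of blocks. 2. For every tract $F$ and every class $x\in\mathrm{Gr}^w_J(F)$, the stabilizer of $x$ in $T(F)$ consists of the $t\in T(F)$ with $t_i=t_j$ whenever $i$ and $j$ are in the same block of $\mathcal B$, where $\mathcal B$ is any decomposition of $J$. 3. For every tract $F$ and every class $x\in\mathrm{Gr}^w_J(F)$, there are a bijection $e\colon T(F).x\to(F^\times)^{n-c(J)}$ and a group homomorphism $\varphi\colon T(F)\to(F^\times)^{n-c(J)}$ with $e(t.x)=\varphi(t)$ for all $t\in T(F)$. 4. For every tract $F$ and every weak $F$-representation $\rho$ of $J$, there is a unique tract morphism $f_\rho\colon\widehat P_J\to F$ with $f_\rho(x_a)=\rho(a)$ for all $a$. There is an isomorphism of tracts $\Phi\colon F_J(x_1,\dots,x_{n-c(J)})\to P_J$ that is the inclusion on $F_J$, and it defines bijections $$\mathrm{Gr}^w_J(F)\longrightarrow\underline{\mathrm{Gr}}^w_J(F)\times(F^\times)^{n-c(J)},\qquad[\rho]\longmapsto\bigl([\rho],\,(f_\rho(\Phi(x_i)))_{i}\bigr),$$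 for all tracts $F$, which are functorial in $F$. 5. If $F$ is an idempotent tract, then $\mathrm{Lin}_J(F)$ is in bijection with $(F^\times)^{n-c(J)}$, by a bijection that is compatible with multiplication. -/

import Mathlib

universe u v w

namespace PolyTract

/-! ## M-convex sets and their decompositions -/

/-- The standard basis vector `ε_i`. -/
def basisVec {ι : Type*} [DecidableEq ι] (i : ι) : ι → ℕ := Pi.single i 1

/-- `J` is an M-convex set of rank `r` on the finite ground set `ι`. -/
structure IsMConvex {ι : Type*} [Fintype ι] [DecidableEq ι] (r : ℕ) (J : Set (ι → ℕ)) : Prop where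
  nonempty : J.Nonempty
  sum_eq : ∀ α ∈ J, ∑ i, α i = r
  exchange : ∀ α ∈ J, ∀ β ∈ J, ∀ i, α i < β i →
    ∃ j, β j < α j ∧ α + basisVec i - basisVec j ∈ J ∧ β - basisVec i + basisVec j ∈ J

/-- `J` is, up to the permutation of the ground set that makes the fibres of `κ` consecutive,
the direct sum of the M-convex sets `K b`, where `K b` has ground set `κ ⁻¹ {b}`. -/
def IsDirectSum {ι : Type*} [Fintype ι] [DecidableEq ι] (J : Set (ι → ℕ)) {m : ℕ} (κ : ι → Fin m)
    (K : ∀ b : Fin m, Set ({j : ι // κ j = b} → ℕ)) : Prop :=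
  (∀ b, ∃ r, IsMConvex r (K b)) ∧
    J = {α | ∀ b, (fun j : {j : ι // κ j = b} => α j.1) ∈ K b}

/-- `J` is indecomposable: its ground set is nonempty, and `J` is not a direct sum of two M-convex
sets with nonempty ground sets. -/
def IsIndecomposable {ι : Type*} [Fintype ι] [DecidableEq ι] (J : Set (ι → ℕ)) : Prop :=
  Nonempty ι ∧ ∀ (κ : ι → Fin 2) (K : ∀ b : Fin 2, Set ({j : ι // κ j = b} → ℕ)),
    Function.Surjective κ → ¬ IsDirectSum J κ K

/-- `κ : ι → Fin m` exhibits `J` as a direct sum of `m` indecomposable M-convex sets, whose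
ground sets are the fibres of `κ`. -/
def IsIndecomposableDecomposition {ι : Type*} [Fintype ι] [DecidableEq ι] (J : Set (ι → ℕ)) {m : ℕ}
    (κ : ι → Fin m) : Prop :=
  ∃ K : ∀ b : Fin m, Set ({j : ι // κ j = b} → ℕ), IsDirectSum J κ K ∧ ∀ b, IsIndecomposable (K b)

/-- An M-convex set of rank `r` on `[n]`. -/
structure MConvexSet (n r : ℕ) where
  carrier : Set (Fin n → ℕ)
  isMConvex : IsMConvex r carrier

namespace MConvexSet

variable {n r : ℕ} (J : MConvexSet n r)

/-- The number `c(J)` of indecomposable components. -/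
noncomputable def numComponents : ℕ :=
  sInf {m | ∃ κ : Fin n → Fin m, IsIndecomposableDecomposition J.carrier κ}

/-- The infimum `δ⁻` of `J`. -/
noncomputable def lower (i : Fin n) : ℕ := sInf ((fun α => α i) '' J.carrier)

/-- The supremum `δ⁺` of `J`. -/
noncomputable def upper (i : Fin n) : ℕ := sSup ((fun α => α i) '' J.carrier)

/-- The width `ω = δ⁺ - δ⁻`. -/
noncomputable def width (i : Fin n) : ℕ := J.upper i - J.lower i

/-- The reduction `J - δ⁻`. -/
def reduction : Set (Fin n → ℕ) := {α | α + J.lower ∈ J.carrier}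

/-- The effective rank `r - |δ⁻|`. -/
noncomputable def effRank : ℕ := r - ∑ i, J.lower i

end MConvexSet

/-- The vector `Σ a = ε_{a_1} + ⋯ + ε_{a_N}` of a tuple `a`. -/
def content {n N : ℕ} (a : Fin N → Fin n) : Fin n → ℕ := ∑ k, basisVec (a k)

/-- The tuple `a i j`, the concatenation of `a` with `(i, j)`. -/
def snoc₂ {n m N : ℕ} (h : m + 2 = N) (a : Fin m → Fin n) (i j : Fin n) : Fin N → Fin n :=
  fun k => Fin.append a ![i, j] (Fin.cast h.symm k)

theorem content_snoc₂ {n m N : ℕ} (h : m + 2 = N) (a : Fin m → Fin n) (i j : Fin n) :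
    content (snoc₂ h a i j) = content a + basisVec i + basisVec j := by
  subst h
  simp [content, snoc₂, Fin.sum_univ_add, add_assoc]

/-- The set of tuples `a` of length the effective rank such that `Σ a` is in the reduction. -/
abbrev MConvexSet.Tuples {n r : ℕ} (J : MConvexSet n r) : Type :=
  {a : Fin J.effRank → Fin n // content a ∈ J.reduction}

/-- The exchange axiom for two vectors at distance at most two. -/
theorem MConvexSet.exchange₂ {n r : ℕ} (J : MConvexSet n r) (a : Fin n → ℕ) (i j k l : Fin n)
    (h₁ : a + basisVec i + basisVec j ∈ J.reduction)
    (h₂ : a + basisVec k + basisVec l ∈ J.reduction) :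
    (a + basisVec i + basisVec k ∈ J.reduction ∧ a + basisVec j + basisVec l ∈ J.reduction) ∨
    (a + basisVec i + basisVec l ∈ J.reduction ∧ a + basisVec j + basisVec k ∈ J.reduction) := by
  by_cases hik : i = k
  · subst hik
    exact Or.inr ⟨h₂, by rwa [add_right_comm] at h₁⟩
  by_cases hil : i = l
  · subst hil
    exact Or.inl ⟨by rwa [add_right_comm] at h₂, by rwa [add_right_comm] at h₁⟩
  by_cases hjk : j = k
  · subst hjk
    exact Or.inl ⟨h₁, h₂⟩
  by_cases hjl : j = l
  · subst hjl
    exact Or.inr ⟨h₁, by rwa [add_right_comm] at h₂⟩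
  have key := J.isMConvex.exchange _ h₁ _ h₂ k (by
    simp only [basisVec, Pi.add_apply, Pi.single_apply]
    split_ifs <;> omega)
  obtain ⟨m, hm, hm₁, hm₂⟩ := key
  have hm' : m = i ∨ m = j := by
    by_contra hcon
    push Not at hcon
    obtain ⟨c1, c2⟩ := hcon
    simp only [basisVec, Pi.add_apply, Pi.single_apply] at hm
    simp only [c1, c2, if_false] at hm
    omega
  rcases hm' with rfl | rfl
  · right
    refine ⟨?_, ?_⟩
    · change _ + J.lower ∈ J.carrier
      convert hm₂ using 1
      funext x
      simp only [basisVec, Pi.add_apply, Pi.sub_apply, Pi.single_apply]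
      split_ifs <;> omega
    · change _ + J.lower ∈ J.carrier
      convert hm₁ using 1
      funext x
      simp only [basisVec, Pi.add_apply, Pi.sub_apply, Pi.single_apply]
      split_ifs <;> omega
  · left
    refine ⟨?_, ?_⟩
    · change _ + J.lower ∈ J.carrier
      convert hm₁ using 1
      funext x
      simp only [basisVec, Pi.add_apply, Pi.sub_apply, Pi.single_apply]
      split_ifs <;> omega
    · change _ + J.lower ∈ J.carrier
      convert hm₂ using 1
      funext x
      simp only [basisVec, Pi.add_apply, Pi.sub_apply, Pi.single_apply]
      split_ifs <;> omega

/-! ## Tracts -/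

/-- The embedding of a pointed group `F` into its ambient semiring `ℕ[Fˣ]`. -/
noncomputable def formal {F : Type u} [CommGroupWithZero F] (a : F) : MonoidAlgebra ℕ Fˣ :=
  open Classical in if h : a = 0 then 0 else MonoidAlgebra.single (Units.mk0 a h) 1

/-- A tract: a pointed abelian group with an ideal of `ℕ[Fˣ]` such that additive inverses exist
and are unique, the additive inverse of `a` being `(-1) * a`. -/
class Tract (F : Type u) extends CommGroupWithZero F where
  /-- The null set. -/
  null : Ideal (MonoidAlgebra ℕ Fˣ)
  /-- The element `-1`. -/
  negOne : Fˣ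
  formal_add_formal_mem_null : ∀ a b : F, formal a + formal b ∈ null ↔ b = (negOne : F) * a

/-- A tract morphism. -/
structure TractHom (F₁ : Type u) (F₂ : Type v) [Tract F₁] [Tract F₂] extends F₁ →*₀ F₂ where
  map_null : ∀ s ∈ Tract.null (F := F₁),
    MonoidAlgebra.mapDomainRingHom ℕ (Units.map (toMonoidWithZeroHom : F₁ →* F₂)) s ∈
      Tract.null (F := F₂)

instance {F₁ : Type u} {F₂ : Type v} [Tract F₁] [Tract F₂] :
    CoeFun (TractHom F₁ F₂) (fun _ => F₁ → F₂) := ⟨fun f => f.toMonoidWithZeroHom⟩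

/-- The homomorphism of unit groups induced by a tract morphism. -/
def TractHom.units {F₁ : Type u} {F₂ : Type v} [Tract F₁] [Tract F₂] (f : TractHom F₁ F₂) :
    F₁ˣ →* F₂ˣ := Units.map (f.toMonoidWithZeroHom : F₁ →* F₂)

/-- An isomorphism of tracts. -/
structure TractIso (F₁ : Type u) (F₂ : Type v) [Tract F₁] [Tract F₂] where
  hom : TractHom F₁ F₂
  inv : TractHom F₂ F₁
  inv_hom : ∀ a, inv (hom a) = a
  hom_inv : ∀ b, hom (inv b) = b

/-- A tract is idempotent if `1 + 1` and `1 + 1 + 1` are null. -/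
def IsIdempotent (F : Type u) [Tract F] : Prop :=
  formal (1 : F) + formal 1 ∈ Tract.null (F := F) ∧
    formal (1 : F) + formal 1 + formal 1 ∈ Tract.null (F := F)

section formal

variable {F : Type u} [CommGroupWithZero F]

theorem formal_zero : formal (0 : F) = 0 := by simp [formal]

theorem formal_unit (a : Fˣ) : formal (a : F) = MonoidAlgebra.single a 1 := by
  simp [formal]

theorem single_mul_formal (u : Fˣ) (a : F) :
    MonoidAlgebra.single u 1 * formal a = formal ((u : F) * a) := by
  by_cases h : a = 0
  · subst h
    simp [formal_zero]
  · lift a to Fˣ using IsUnit.mk0 a h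
    rw [formal_unit, ← Units.val_mul, formal_unit, MonoidAlgebra.single_mul_single, one_mul]

theorem map_formal {F₂ : Type v} [CommGroupWithZero F₂] (f : F →*₀ F₂) (a : F) :
    MonoidAlgebra.mapDomainRingHom ℕ (Units.map (f : F →* F₂)) (formal a) = formal (f a) := by
  by_cases h : a = 0
  · subst h
    simp [formal_zero]
  · lift a to Fˣ using IsUnit.mk0 a h
    have : f (a : F) = ((Units.map (f : F →* F₂) a : F₂ˣ) : F₂) := rfl
    rw [formal_unit, this, formal_unit, MonoidAlgebra.mapDomainRingHom_apply,
      MonoidAlgebra.mapDomain_single]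

theorem coeff_formal_ne_zero {a : F} {u : Fˣ} (h : (formal a).coeff u ≠ 0) : a = u := by
  by_cases ha : a = 0
  · subst ha
    simp [formal_zero] at h
  · lift a to Fˣ using IsUnit.mk0 a ha
    rw [formal_unit] at h
    by_contra hne
    apply h
    have : a ≠ u := fun e => hne (by rw [e])
    simp [this]

end formal

theorem map_map {G : Type u} {H : Type v} {K : Type w} [CommGroup G] [CommGroup H] [CommGroup K]
    (g : H →* K) (f : G →* H) (s : MonoidAlgebra ℕ G) :
    MonoidAlgebra.mapDomainRingHom ℕ g (MonoidAlgebra.mapDomainRingHom ℕ f s) =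
      MonoidAlgebra.mapDomainRingHom ℕ (g.comp f) s := by
  rw [MonoidAlgebra.mapDomainRingHom_comp, RingHom.comp_apply]

theorem map_single {G : Type u} {H : Type v} [CommGroup G] [CommGroup H] (f : G →* H) (a : G)
    (k : ℕ) : MonoidAlgebra.mapDomainRingHom ℕ f (MonoidAlgebra.single a k) =
      MonoidAlgebra.single (f a) k := by
  rw [MonoidAlgebra.mapDomainRingHom_apply, MonoidAlgebra.mapDomain_single]

section mass

variable {G : Type u} [CommGroup G]

/-- The number of terms of a formal sum. -/
noncomputable def mass : MonoidAlgebra ℕ G →+* ℕ :=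
  (MonoidAlgebra.lift ℕ ℕ G (1 : G →* ℕ)).toRingHom

theorem mass_single (g : G) (k : ℕ) : mass (MonoidAlgebra.single g k) = k := by
  simp [mass]

theorem exists_multiset (s : MonoidAlgebra ℕ G) :
    ∃ m : Multiset G, s = (m.map fun g => MonoidAlgebra.single g 1).sum ∧
      mass s = Multiset.card m := by
  induction s using MonoidAlgebra.induction_linear with
  | zero => exact ⟨0, by simp⟩
  | add f g hf hg =>
    obtain ⟨m, hm, hm'⟩ := hf
    obtain ⟨k, hk, hk'⟩ := hg
    exact ⟨m + k, by simp [← hm, ← hk], by simp [hm', hk']⟩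
  | single g k =>
    refine ⟨Multiset.replicate k g, ?_, ?_⟩
    · simp [MonoidAlgebra.smul_single]
    · simp [mass_single]

theorem eq_of_mass_eq_zero {s : MonoidAlgebra ℕ G} (h : mass s = 0) : s = 0 := by
  obtain ⟨m, hm, hm'⟩ := exists_multiset s
  rw [h] at hm'
  rw [Multiset.card_eq_zero.mp hm'.symm] at hm
  simpa using hm

theorem eq_of_mass_eq_one {s : MonoidAlgebra ℕ G} (h : mass s = 1) :
    ∃ g, s = MonoidAlgebra.single g 1 := by
  obtain ⟨m, hm, hm'⟩ := exists_multiset s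
  rw [h] at hm'
  obtain ⟨g, hg⟩ := Multiset.card_eq_one.mp hm'.symm
  exact ⟨g, by simpa [hg] using hm⟩

theorem eq_of_mass_eq_two {s : MonoidAlgebra ℕ G} (h : mass s = 2) :
    ∃ g k, s = MonoidAlgebra.single g 1 + MonoidAlgebra.single k 1 := by
  obtain ⟨m, hm, hm'⟩ := exists_multiset s
  rw [h] at hm'
  obtain ⟨g, k, hg⟩ := Multiset.card_eq_two.mp hm'.symm
  exact ⟨g, k, by simpa [hg] using hm⟩

theorem eq_or_eq_of_single_add_single {a b c d : G}
    (h : (MonoidAlgebra.single a 1 + MonoidAlgebra.single b 1 : MonoidAlgebra ℕ G) =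
      MonoidAlgebra.single c 1 + MonoidAlgebra.single d 1) :
    (a = c ∧ b = d) ∨ (a = d ∧ b = c) := by
  classical
  have key : ∀ x, (if a = x then 1 else 0) + (if b = x then 1 else 0) =
      (if c = x then 1 else 0) + (if d = x then 1 else 0) := by
    intro x
    have := congrArg (fun s : MonoidAlgebra ℕ G => s.coeff x) h
    simpa [Finsupp.single_apply] using this
  have h1 := key a
  have h2 := key b
  have h3 := key c
  by_cases e1 : a = c
  · subst e1
    left
    refine ⟨rfl, ?_⟩
    by_contra hbd
    have hbd' : d ≠ b := fun e => hbd e.symm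
    simp [hbd'] at h2
  · have e1' : c ≠ a := fun e => e1 e.symm
    have e2 : d = a := by
      by_contra hh
      simp [e1', hh] at h1
    subst e2
    right
    refine ⟨rfl, ?_⟩
    by_contra hbc
    simp [e1, hbc] at h3

/-- The ideal of all formal sums that are zero, of the form `g + ε g`, or have at least three
terms. -/
noncomputable def degenerateIdeal (ε : G) : Ideal (MonoidAlgebra ℕ G) where
  carrier := {s | s = 0 ∨ (∃ g, s = MonoidAlgebra.single g 1 + MonoidAlgebra.single (ε * g) 1) ∨
    3 ≤ mass s}
  zero_mem' := Or.inl rfl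
  add_mem' := by
    have two : ∀ s : MonoidAlgebra ℕ G,
        ((∃ g, s = MonoidAlgebra.single g 1 + MonoidAlgebra.single (ε * g) 1) ∨ 3 ≤ mass s) →
        2 ≤ mass s := by
      rintro s (⟨g, rfl⟩ | h)
      · simp [mass_single]
      · omega
    rintro s t (rfl | hs) ht
    · simpa using ht
    · rcases ht with rfl | ht
      · simpa using Or.inr hs
      · right
        right
        have := two s hs
        have := two t ht
        rw [map_add]
        omega
  smul_mem' := by
    rintro t s hs
    rcases Nat.lt_or_ge (mass t) 2 with ht | ht
    · interval_cases h : mass t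
      · left
        rw [eq_of_mass_eq_zero h, zero_smul]
      · obtain ⟨k, rfl⟩ := eq_of_mass_eq_one h
        rcases hs with rfl | ⟨g, rfl⟩ | hs
        · left
          simp
        · right
          left
          refine ⟨k * g, ?_⟩
          simp [mul_add, MonoidAlgebra.single_mul_single, mul_left_comm]
        · right
          right
          simpa [mass_single] using hs
    · rcases hs with rfl | ⟨g, rfl⟩ | hs
      · left
        simp
      · right
        right
        simp only [smul_eq_mul, map_mul, map_add, mass_single]
        omega
      · right
        right
        simp only [smul_eq_mul, map_mul]
        nlinarith

theorem single_add_single_mem_iff {N : Ideal (MonoidAlgebra ℕ G)} {ε : G} (hε : ε * ε = 1)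
    (h₁ : MonoidAlgebra.single 1 1 + MonoidAlgebra.single ε 1 ∈ N) (h₂ : N ≤ degenerateIdeal ε)
    (a b : G) : MonoidAlgebra.single a 1 + MonoidAlgebra.single b 1 ∈ N ↔ b = ε * a := by
  constructor
  · intro h
    rcases h₂ h with h | ⟨g, h⟩ | h
    · have := congrArg mass h
      simp [mass_single] at this
    · rcases eq_or_eq_of_single_add_single h with ⟨rfl, rfl⟩ | ⟨rfl, rfl⟩
      · rfl
      · rw [← mul_assoc, hε, one_mul]
    · simp [mass_single] at h
  · rintro rfl
    have := N.mul_mem_left (MonoidAlgebra.single a 1) h₁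
    simpa [mul_add, MonoidAlgebra.single_mul_single, mul_comm] using this

theorem single_notMem {N : Ideal (MonoidAlgebra ℕ G)} {ε : G} (h₂ : N ≤ degenerateIdeal ε)
    (a : G) : MonoidAlgebra.single a 1 ∉ N := by
  intro h
  rcases h₂ h with h | ⟨g, h⟩ | h
  · have := congrArg mass h
    simp [mass_single] at this
  · have := congrArg mass h
    simp [mass_single] at this
  · simp [mass_single] at h

theorem map_mem_degenerateIdeal {H : Type v} [CommGroup H] (f : G →* H) {ε : G} {s}
    (hs : s ∈ degenerateIdeal ε) :
    MonoidAlgebra.mapDomainRingHom ℕ f s ∈ degenerateIdeal (f ε) := by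
  have hm : ∀ t : MonoidAlgebra ℕ G, mass (MonoidAlgebra.mapDomainRingHom ℕ f t) = mass t := by
    intro t
    induction t using MonoidAlgebra.induction_linear with
    | zero => simp
    | add a b ha hb => simp only [map_add, ha, hb]
    | single a k => simp [mass_single, MonoidAlgebra.mapDomain_single]
  rcases hs with rfl | ⟨g, rfl⟩ | hs
  · left
    simp
  · right
    left
    exact ⟨f g, by rw [map_add, map_single, map_single, map_mul]⟩
  · right
    right
    rwa [hm]

end mass

namespace Tract

variable {F : Type u} [Tract F]

theorem single_mem_iff (a b : Fˣ) :
    MonoidAlgebra.single a 1 + MonoidAlgebra.single b 1 ∈ null (F := F) ↔ b = negOne * a := by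
  rw [← formal_unit, ← formal_unit, formal_add_formal_mem_null, ← Units.val_mul, Units.val_inj]

theorem single_notMem_null (a : Fˣ) : MonoidAlgebra.single a 1 ∉ null (F := F) := by
  intro h
  have := (formal_add_formal_mem_null (a : F) 0).mp (by simpa [formal_zero, formal_unit] using h)
  exact absurd this.symm (by rw [← Units.val_mul]; exact Units.ne_zero _)

theorem negOne_mul_self : (negOne : Fˣ) * negOne = 1 := by
  have h := (single_mem_iff (1 : Fˣ) negOne).mpr (by simp)
  rw [add_comm] at h
  exact ((single_mem_iff _ _).mp h).symm

theorem null_le_degenerateIdeal : null (F := F) ≤ degenerateIdeal negOne := by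
  intro s hs
  rcases Nat.lt_or_ge (mass s) 3 with h | h
  · interval_cases h' : mass s
    · exact Or.inl (eq_of_mass_eq_zero h')
    · obtain ⟨g, rfl⟩ := eq_of_mass_eq_one h'
      exact absurd hs (single_notMem_null g)
    · obtain ⟨g, k, rfl⟩ := eq_of_mass_eq_two h'
      right
      left
      exact ⟨g, by rw [(single_mem_iff g k).mp hs]⟩
  · exact Or.inr (Or.inr h)

/-- The tract with unit group `G`, null set `N` (viewed in `ℕ[G]`) and `-1 = ε`. -/
@[reducible]
noncomputable def ofUnits {G : Type u} [CommGroup G] (N : Ideal (MonoidAlgebra ℕ G)) (ε : G)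
    (h₁ : ∀ a b, MonoidAlgebra.single a 1 + MonoidAlgebra.single b 1 ∈ N ↔ b = ε * a)
    (h₂ : ∀ a, MonoidAlgebra.single a 1 ∉ N) : Tract (WithZero G) where
  null := N.comap (MonoidAlgebra.mapDomainRingHom ℕ
    (WithZero.unitsWithZeroEquiv (α := G)).toMonoidHom)
  negOne := WithZero.unitsWithZeroEquiv.symm ε
  formal_add_formal_mem_null := by
    intro a b
    by_cases ha : a = 0 <;> by_cases hb : b = 0
    · subst ha
      subst hb
      simp [formal_zero]
    · subst ha
      lift b to (WithZero G)ˣ using IsUnit.mk0 b hb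
      simp [formal_zero, formal_unit, MonoidAlgebra.mapDomain_single, h₂]
    · subst hb
      lift a to (WithZero G)ˣ using IsUnit.mk0 a ha
      rw [formal_zero, add_zero, formal_unit, Ideal.mem_comap,
        MonoidAlgebra.mapDomainRingHom_apply, MonoidAlgebra.mapDomain_single]
      simp only [h₂, false_iff]
      rw [← Units.val_mul]
      exact (Units.ne_zero _).symm
    · lift a to (WithZero G)ˣ using IsUnit.mk0 a ha
      lift b to (WithZero G)ˣ using IsUnit.mk0 b hb
      rw [formal_unit, formal_unit, Ideal.mem_comap, map_add,
        MonoidAlgebra.mapDomainRingHom_apply, MonoidAlgebra.mapDomainRingHom_apply,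
        MonoidAlgebra.mapDomain_single, MonoidAlgebra.mapDomain_single, h₁, ← Units.val_mul,
        Units.val_inj, ← WithZero.unitsWithZeroEquiv.injective.eq_iff, map_mul,
        MulEquiv.apply_symm_apply]
      rfl

end Tract

/-! ### The regular partial field -/

/-- The regular partial field `{0, 1, -1}`. -/
def RegularPartialField : Type := WithZero ℤˣ

noncomputable instance : Tract RegularPartialField :=
  have h₁ : MonoidAlgebra.single (1 : ℤˣ) 1 + MonoidAlgebra.single (-1) 1 ∈
      Ideal.span {(MonoidAlgebra.single (1 : ℤˣ) 1 + MonoidAlgebra.single (-1) 1 :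
        MonoidAlgebra ℕ ℤˣ)} := Ideal.subset_span rfl
  have h₂ : Ideal.span {(MonoidAlgebra.single (1 : ℤˣ) 1 + MonoidAlgebra.single (-1) 1 :
      MonoidAlgebra ℕ ℤˣ)} ≤ degenerateIdeal (-1) := by
    rw [Ideal.span_singleton_le_iff_mem]
    exact Or.inr (Or.inl ⟨1, by simp⟩)
  Tract.ofUnits (Ideal.span {MonoidAlgebra.single (1 : ℤˣ) 1 + MonoidAlgebra.single (-1) 1}) (-1)
    (single_add_single_mem_iff (by simp) h₁ h₂) (single_notMem h₂)

/-! ### Subtracts -/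

/-- The subtract of `F` with unit group `H`, where `-1 ∈ H`. Its null set consists of the formal
sums over `H` that are null in `F`. -/
def Subtract (F : Type u) [Tract F] (H : Subgroup Fˣ) (_hH : Tract.negOne ∈ H) : Type u :=
  WithZero H

namespace Subtract

variable {F : Type u} [Tract F] {H : Subgroup Fˣ} {hH : Tract.negOne ∈ H}

noncomputable instance : Tract (Subtract F H hH) :=
  Tract.ofUnits (Tract.null.comap (MonoidAlgebra.mapDomainRingHom ℕ H.subtype)) ⟨_, hH⟩
    (by
      intro a b
      rw [Ideal.mem_comap, map_add, MonoidAlgebra.mapDomainRingHom_apply,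
        MonoidAlgebra.mapDomainRingHom_apply, MonoidAlgebra.mapDomain_single,
        MonoidAlgebra.mapDomain_single, Tract.single_mem_iff, Subtype.ext_iff]
      rfl)
    (by
      intro a
      rw [Ideal.mem_comap, MonoidAlgebra.mapDomainRingHom_apply, MonoidAlgebra.mapDomain_single]
      exact Tract.single_notMem_null _)

/-- The unit group of a subtract. -/
def unitsEquiv : (Subtract F H hH)ˣ ≃* H := WithZero.unitsWithZeroEquiv

theorem mem_null_iff (s : MonoidAlgebra ℕ (Subtract F H hH)ˣ) :
    s ∈ Tract.null ↔ MonoidAlgebra.mapDomainRingHom ℕ (H.subtype.comp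
      (unitsEquiv (hH := hH)).toMonoidHom) s ∈ Tract.null (F := F) := by
  rw [← map_map]
  rfl

/-- The inclusion of a subtract. -/
noncomputable def incl : TractHom (Subtract F H hH) F where
  toMonoidWithZeroHom :=
    (WithZero.lift' ((Units.coeHom F).comp H.subtype) : WithZero H →*₀ F)
  map_null := fun s hs => by
    refine Eq.subst (motive := (· ∈ Tract.null)) (congrArg (fun φ : (Subtract F H hH)ˣ →* Fˣ =>
      MonoidAlgebra.mapDomainRingHom ℕ φ s) (MonoidHom.ext fun x => ?_)) ((mem_null_iff s).mp hs)
    obtain ⟨y, rfl⟩ := (unitsEquiv (hH := hH)).symm.surjective x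
    rfl

/-- The inclusion between two subtracts of a tract. -/
noncomputable def inclusion {K : Subgroup Fˣ} {hK : Tract.negOne ∈ K} (h : H ≤ K) :
    TractHom (Subtract F H hH) (Subtract F K hK) where
  toMonoidWithZeroHom := (WithZero.map' (Subgroup.inclusion h) : WithZero H →*₀ WithZero K)
  map_null := fun s hs => by
    rw [mem_null_iff, map_map]
    refine Eq.subst (motive := (· ∈ Tract.null)) (congrArg (fun φ : (Subtract F H hH)ˣ →* Fˣ =>
      MonoidAlgebra.mapDomainRingHom ℕ φ s) (MonoidHom.ext fun x => ?_)) ((mem_null_iff s).mp hs)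
    obtain ⟨y, rfl⟩ := (unitsEquiv (hH := hH)).symm.surjective x
    rfl

end Subtract

/-! ### Free algebras -/

/-- The free algebra `k(x_i)_{i ∈ I}`: its nonzero elements are the `a ∏ x_i ^ e_i` with `a ∈ kˣ`
and finitely supported integer exponents, and its null set is generated by the null set of `k`. -/
def FreeAlgebra (k : Type u) [Tract k] (I : Type v) : Type (max u v) :=
  WithZero (kˣ × Multiplicative (I →₀ ℤ))

namespace FreeAlgebra

variable {k : Type u} [Tract k] {I : Type v}

noncomputable instance : Tract (FreeAlgebra k I) :=
  have h₁ : MonoidAlgebra.single 1 1 + MonoidAlgebra.single (Tract.negOne, 1) 1 ∈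
      (Tract.null (F := k)).map (MonoidAlgebra.mapDomainRingHom ℕ
        (MonoidHom.inl kˣ (Multiplicative (I →₀ ℤ)))) := by
    have := Ideal.mem_map_of_mem (MonoidAlgebra.mapDomainRingHom ℕ
        (MonoidHom.inl kˣ (Multiplicative (I →₀ ℤ))))
        ((Tract.single_mem_iff (1 : kˣ) Tract.negOne).mpr (by simp))
    rwa [map_add, map_single, map_single] at this
  have h₂ : (Tract.null (F := k)).map (MonoidAlgebra.mapDomainRingHom ℕ
        (MonoidHom.inl kˣ (Multiplicative (I →₀ ℤ)))) ≤ degenerateIdeal (Tract.negOne, 1) :=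
    Ideal.map_le_iff_le_comap.mpr fun _ hs =>
      map_mem_degenerateIdeal (MonoidHom.inl kˣ (Multiplicative (I →₀ ℤ)))
        (Tract.null_le_degenerateIdeal hs)
  Tract.ofUnits ((Tract.null (F := k)).map (MonoidAlgebra.mapDomainRingHom ℕ
        (MonoidHom.inl kˣ (Multiplicative (I →₀ ℤ))))) (Tract.negOne, 1)
    (single_add_single_mem_iff (by simp [Tract.negOne_mul_self]) h₁ h₂) (single_notMem h₂)

/-- The unit group of a free algebra. -/
noncomputable def unitsEquiv : (FreeAlgebra k I)ˣ ≃* kˣ × Multiplicative (I →₀ ℤ) :=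
  WithZero.unitsWithZeroEquiv

open Classical in
/-- The structure map `k → k(x_i)`. -/
noncomputable def const : TractHom k (FreeAlgebra k I) where
  toFun a := if h : a = 0 then 0 else
    (unitsEquiv.symm (Units.mk0 a h, 1) : (FreeAlgebra k I)ˣ)
  map_zero' := by simp
  map_one' := by
    rw [dif_neg one_ne_zero, Units.mk0_one]
    exact congrArg Units.val (map_one (unitsEquiv (k := k) (I := I)).symm)
  map_mul' a b := by
    by_cases ha : a = 0
    · simp [ha]
    by_cases hb : b = 0
    · simp [hb]
    simp only [ha, hb, dite_false, mul_eq_zero, or_self, Units.mk0_mul]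
    rw [← Units.val_mul, ← map_mul, Prod.mk_mul_mk, one_mul]
  map_null := fun s hs => by
    change MonoidAlgebra.mapDomainRingHom ℕ (unitsEquiv (k := k) (I := I)).toMonoidHom _ ∈
      (Tract.null (F := k)).map _
    rw [map_map]
    refine Eq.subst (motive := (· ∈ (Tract.null (F := k)).map _))
      (congrArg (fun φ : kˣ →* kˣ × Multiplicative (I →₀ ℤ) =>
        MonoidAlgebra.mapDomainRingHom ℕ φ s) (MonoidHom.ext fun x => ?_))
      (Ideal.mem_map_of_mem (MonoidAlgebra.mapDomainRingHom ℕ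
        (MonoidHom.inl kˣ (Multiplicative (I →₀ ℤ)))) hs)
    symm
    apply (unitsEquiv (k := k) (I := I)).symm.injective
    apply Units.ext
    change ((unitsEquiv (k := k) (I := I)).symm (unitsEquiv _) : FreeAlgebra k I) = _
    rw [MulEquiv.symm_apply_apply]
    change dite _ _ _ = _
    rw [dif_neg x.ne_zero, Units.mk0_val]
    rfl

/-- The variable `x_i`, as a unit. -/
noncomputable def X (i : I) : (FreeAlgebra k I)ˣ :=
  unitsEquiv.symm (1, Multiplicative.ofAdd (Finsupp.single i 1))

/-- The exponents `(e_i)` of a unit `a ∏ x_i ^ e_i`. -/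
noncomputable def exponents : (FreeAlgebra k I)ˣ →* Multiplicative (I →₀ ℤ) :=
  (MonoidHom.snd kˣ (Multiplicative (I →₀ ℤ))).comp unitsEquiv.toMonoidHom

theorem exponents_X (i : I) :
    exponents (X i : (FreeAlgebra k I)ˣ) = Multiplicative.ofAdd (Finsupp.single i 1) := rfl

theorem exponents_negOne : exponents (Tract.negOne : (FreeAlgebra k I)ˣ) = 1 := rfl

end FreeAlgebra

/-! ### Quotients -/

/-- The subgroup of all units that become `1` in the quotient of `F` by `S`: it is generated by the
`a / b` with `a - b ∈ S`. -/
def relSubgroup {F : Type u} [Tract F] (S : Set (MonoidAlgebra ℕ Fˣ)) : Subgroup Fˣ :=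
  Subgroup.closure {c | ∃ a b : Fˣ, MonoidAlgebra.single a 1 +
    MonoidAlgebra.single (Tract.negOne * b) 1 ∈ S ∧ c = a / b}

/-- The quotient of a tract `F` by a set `S` of formal sums that contains no unit of `F`. Its null
set is generated by the images of the null set of `F` and of `S`. -/
def TractQuotient (F : Type u) [Tract F] (S : Set (MonoidAlgebra ℕ Fˣ))
    (_hS : ∀ a, MonoidAlgebra.single a 1 ∉ S) : Type u :=
  WithZero (Fˣ ⧸ relSubgroup S)

namespace TractQuotient

variable {F : Type u} [Tract F] {S : Set (MonoidAlgebra ℕ Fˣ)}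
  {hS : ∀ a, MonoidAlgebra.single a 1 ∉ S}

theorem map_mem_degenerateIdeal (hS : ∀ a, MonoidAlgebra.single a 1 ∉ S) {s} (hs : s ∈ S) :
    MonoidAlgebra.mapDomainRingHom ℕ (QuotientGroup.mk' (relSubgroup S)) s ∈
      degenerateIdeal (QuotientGroup.mk' (relSubgroup S) Tract.negOne) := by
  rcases Nat.lt_or_ge (mass s) 3 with h | h
  · interval_cases h' : mass s
    · left
      rw [eq_of_mass_eq_zero h', map_zero]
    · obtain ⟨g, rfl⟩ := eq_of_mass_eq_one h'
      exact absurd hs (hS g)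
    · obtain ⟨g, k, rfl⟩ := eq_of_mass_eq_two h'
      right
      left
      refine ⟨QuotientGroup.mk' (relSubgroup S) k, ?_⟩
      rw [map_add, map_single, map_single, ← map_mul, add_comm]
      have : QuotientGroup.mk' (relSubgroup S) g =
          QuotientGroup.mk' (relSubgroup S) (Tract.negOne * k) := by
        rw [← div_eq_one, ← map_div, ← MonoidHom.mem_ker, QuotientGroup.ker_mk']
        refine Subgroup.subset_closure ⟨g, Tract.negOne * k, ?_, rfl⟩
        rwa [← mul_assoc, Tract.negOne_mul_self, one_mul]
      rw [this]
  · exact PolyTract.map_mem_degenerateIdeal _ (Or.inr (Or.inr h))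

/-- The null set of a quotient, as an ideal of the group semiring of its unit group. -/
noncomputable def nullIdeal (S : Set (MonoidAlgebra ℕ Fˣ)) :
    Ideal (MonoidAlgebra ℕ (Fˣ ⧸ relSubgroup S)) :=
  Ideal.span (MonoidAlgebra.mapDomainRingHom ℕ (QuotientGroup.mk' (relSubgroup S)) ''
    ((Tract.null (F := F) : Set (MonoidAlgebra ℕ Fˣ)) ∪ S))

theorem nullIdeal_le (hS : ∀ a, MonoidAlgebra.single a 1 ∉ S) :
    nullIdeal S ≤ degenerateIdeal (QuotientGroup.mk' (relSubgroup S) Tract.negOne) := by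
  rw [nullIdeal, Ideal.span_le]
  rintro _ ⟨s, hs | hs, rfl⟩
  · exact PolyTract.map_mem_degenerateIdeal _ (Tract.null_le_degenerateIdeal hs)
  · exact map_mem_degenerateIdeal hS hs

theorem one_add_negOne_mem : MonoidAlgebra.single 1 1 + MonoidAlgebra.single
    (QuotientGroup.mk' (relSubgroup S) Tract.negOne) 1 ∈ nullIdeal S := by
  refine Ideal.subset_span ⟨_, Or.inl ((Tract.single_mem_iff (1 : Fˣ) Tract.negOne).mpr
    (by simp)), ?_⟩
  rw [map_add, map_single, map_single, map_one]

theorem mk_negOne_mul_self : QuotientGroup.mk' (relSubgroup S) Tract.negOne *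
    QuotientGroup.mk' (relSubgroup S) Tract.negOne = 1 := by
  rw [← map_mul, Tract.negOne_mul_self, map_one]

noncomputable instance : Tract (TractQuotient F S hS) :=
  Tract.ofUnits (nullIdeal S) (QuotientGroup.mk' (relSubgroup S) Tract.negOne)
    (single_add_single_mem_iff mk_negOne_mul_self one_add_negOne_mem (nullIdeal_le hS))
    (single_notMem (nullIdeal_le hS))

/-- The unit group of a quotient. -/
def unitsEquiv : (TractQuotient F S hS)ˣ ≃* Fˣ ⧸ relSubgroup S := WithZero.unitsWithZeroEquiv

open Classical in
/-- The quotient map. -/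
noncomputable def mk (a : F) : TractQuotient F S hS :=
  if h : a = 0 then 0 else
    unitsEquiv.symm (QuotientGroup.mk' (relSubgroup S) (Units.mk0 a h))

/-- The homomorphism on the units of the quotient that is induced by a homomorphism on `Fˣ`. -/
noncomputable def unitsLift {A : Type v} [CommGroup A] (d : Fˣ →* A) (hd : relSubgroup S ≤ d.ker) :
    (TractQuotient F S hS)ˣ →* A :=
  (QuotientGroup.lift (relSubgroup S) d hd).comp unitsEquiv.toMonoidHom

theorem unitsLift_negOne {A : Type v} [CommGroup A] (d : Fˣ →* A) (hd : relSubgroup S ≤ d.ker) :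
    unitsLift (hS := hS) d hd Tract.negOne = d Tract.negOne := rfl

end TractQuotient

/-! ## Weak representations -/

/-- The sign of a permutation as an element of a tract. -/
noncomputable def signIn (F : Type u) [Tract F] {N : ℕ} (σ : Equiv.Perm (Fin N)) : Fˣ :=
  if Equiv.Perm.sign σ = 1 then 1 else Tract.negOne

/-- The `3`-term Plücker expression
`ρ(aij) ρ(akl) - ρ(aik) ρ(ajl) + ρ(ail) ρ(ajk)`. -/
noncomputable def plucker₃ {F : Type u} [Tract F] {n m N : ℕ} (h : m + 2 = N)
    (ρ : (Fin N → Fin n) → F) (a : Fin m → Fin n) (i j k l : Fin n) : MonoidAlgebra ℕ Fˣ :=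
  formal (ρ (snoc₂ h a i j) * ρ (snoc₂ h a k l)) +
    formal (((Tract.negOne : Fˣ) : F) * (ρ (snoc₂ h a i k) * ρ (snoc₂ h a j l))) +
    formal (ρ (snoc₂ h a i l) * ρ (snoc₂ h a j k))

/-- A weak `F`-representation of `J`. -/
@[ext]
structure WeakRep {n r : ℕ} (J : MConvexSet n r) (F : Type u) [Tract F] where
  toFun : (Fin J.effRank → Fin n) → F
  isUnit_iff : ∀ a, IsUnit (toFun a) ↔ content a ∈ J.reduction
  comp_perm : ∀ (a : Fin J.effRank → Fin n) (σ : Equiv.Perm (Fin J.effRank)),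
    toFun (a ∘ σ) = (signIn F σ : F) * toFun a
  plucker : ∀ (m : ℕ) (h : m + 2 = J.effRank) (a : Fin m → Fin n) (i j k l : Fin n),
    content a + basisVec i + basisVec j + basisVec k + basisVec l ≤ J.width →
    plucker₃ h toFun a i j k l ∈ Tract.null (F := F)

namespace MConvexSet

variable {n r : ℕ} (J : MConvexSet n r)

theorem exchange₃ (a : Fin n → ℕ) (i j k l : Fin n) :
    let P₁ := a + basisVec i + basisVec j ∈ J.reduction ∧ a + basisVec k + basisVec l ∈ J.reduction
    let P₂ := a + basisVec i + basisVec k ∈ J.reduction ∧ a + basisVec j + basisVec l ∈ J.reduction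
    let P₃ := a + basisVec i + basisVec l ∈ J.reduction ∧ a + basisVec j + basisVec k ∈ J.reduction
    (P₁ → P₂ ∨ P₃) ∧ (P₂ → P₁ ∨ P₃) ∧ (P₃ → P₁ ∨ P₂) := by
  refine ⟨fun h => J.exchange₂ a i j k l h.1 h.2, fun h => ?_, fun h => ?_⟩
  · have := J.exchange₂ a i k j l h.1 h.2
    rwa [add_right_comm a (basisVec k) (basisVec j)] at this
  · have := J.exchange₂ a i l j k h.1 h.2
    rwa [add_right_comm a (basisVec l) (basisVec k), add_right_comm a (basisVec l) (basisVec j)]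
      at this

end MConvexSet

theorem content_comp {n N : ℕ} (a : Fin N → Fin n) (σ : Equiv.Perm (Fin N)) :
    content (a ∘ σ) = content a :=
  Equiv.sum_comp σ fun k => basisVec (a k)

theorem mass_formal {F : Type u} [CommGroupWithZero F] (a : F) [Decidable (a = 0)] :
    mass (formal a) = if a = 0 then 0 else 1 := by
  by_cases h : a = 0
  · simp [h, formal_zero]
  · lift a to Fˣ using IsUnit.mk0 a h
    rw [formal_unit, mass_single, if_neg h]

namespace WeakRep

variable {n r : ℕ} {J : MConvexSet n r} {F : Type u} [Tract F]

instance : CoeFun (WeakRep J F) (fun _ => (Fin J.effRank → Fin n) → F) := ⟨toFun⟩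

theorem negOne_eq_one (h : IsIdempotent F) : (Tract.negOne : Fˣ) = 1 := by
  have := (Tract.formal_add_formal_mem_null (1 : F) 1).mp h.1
  rw [mul_one] at this
  exact (Units.ext this).symm

open Classical in
/-- The trivial representation over an idempotent tract. -/
noncomputable def trivial (J : MConvexSet n r) (h : IsIdempotent F) : WeakRep J F where
  toFun a := if content a ∈ J.reduction then 1 else 0
  isUnit_iff a := by split_ifs with ha <;> simp [ha]
  comp_perm a σ := by simp [content_comp, signIn, negOne_eq_one h]
  plucker m hm a i j k l _ := by
    have key := J.exchange₃ (content a) i j k l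
    simp only [plucker₃, content_snoc₂, negOne_eq_one h, Units.val_one, mul_ite, mul_one,
      mul_zero, ← ite_and]
    dsimp only at key
    have h2 := h.1
    have h3 := h.2
    have e0 : formal (0 : F) = 0 := formal_zero
    obtain ⟨A, hA⟩ : ∃ P : Prop, P = (content a + basisVec i + basisVec j ∈ J.reduction) :=
      ⟨_, rfl⟩
    obtain ⟨A', hA'⟩ : ∃ P : Prop, P = (content a + basisVec k + basisVec l ∈ J.reduction) :=
      ⟨_, rfl⟩
    obtain ⟨B, hB⟩ : ∃ P : Prop, P = (content a + basisVec i + basisVec k ∈ J.reduction) :=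
      ⟨_, rfl⟩
    obtain ⟨B', hB'⟩ : ∃ P : Prop, P = (content a + basisVec j + basisVec l ∈ J.reduction) :=
      ⟨_, rfl⟩
    obtain ⟨C, hC⟩ : ∃ P : Prop, P = (content a + basisVec i + basisVec l ∈ J.reduction) :=
      ⟨_, rfl⟩
    obtain ⟨C', hC'⟩ : ∃ P : Prop, P = (content a + basisVec j + basisVec k ∈ J.reduction) :=
      ⟨_, rfl⟩
    simp only [← hA, ← hA', ← hB, ← hB', ← hC, ← hC'] at key ⊢
    clear hA hA' hB hB' hC hC'
    by_cases A <;> by_cases A' <;> by_cases B <;> by_cases B' <;> by_cases C <;> by_cases C' <;>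
      simp_all

end WeakRep

theorem TractHom.map_negOne {F₁ : Type u} {F₂ : Type v} [Tract F₁] [Tract F₂]
    (f : TractHom F₁ F₂) : f ((Tract.negOne : F₁ˣ) : F₁) = ((Tract.negOne : F₂ˣ) : F₂) := by
  have h := f.map_null _ ((Tract.formal_add_formal_mem_null (1 : F₁)
    ((Tract.negOne : F₁ˣ) : F₁)).mpr (by simp))
  rw [map_add, map_formal, map_formal, Tract.formal_add_formal_mem_null, map_one, mul_one] at h
  exact h

theorem TractHom.map_signIn {F₁ : Type u} {F₂ : Type v} [Tract F₁] [Tract F₂]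
    (f : TractHom F₁ F₂) {N : ℕ} (σ : Equiv.Perm (Fin N)) :
    f ((signIn F₁ σ : F₁ˣ) : F₁) = ((signIn F₂ σ : F₂ˣ) : F₂) := by
  unfold signIn
  split_ifs
  · exact map_one f.toMonoidWithZeroHom
  · exact f.map_negOne

namespace WeakRep

variable {n r : ℕ} {J : MConvexSet n r} {F : Type u} [Tract F]

/-- The push-forward of a weak representation along a tract morphism. -/
noncomputable def map {F₂ : Type v} [Tract F₂] (f : TractHom F F₂) (ρ : WeakRep J F) :
    WeakRep J F₂ where
  toFun a := f (ρ a)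
  isUnit_iff a := by
    rw [← ρ.isUnit_iff, isUnit_iff_ne_zero, isUnit_iff_ne_zero]
    exact map_ne_zero f.toMonoidWithZeroHom
  comp_perm a σ := by
    rw [ρ.comp_perm, ← f.map_signIn]
    exact map_mul f.toMonoidWithZeroHom _ _
  plucker m h a i j k l hw := by
    have := f.map_null _ (ρ.plucker m h a i j k l hw)
    simpa only [plucker₃, map_add, map_formal, map_mul, f.map_negOne] using this

/-- The value at `a` of the character of the torus `(Fˣ)ⁿ` with weight `Σ a`. -/
def weight {N : ℕ} (t : Fin n → Fˣ) (a : Fin N → Fin n) : Fˣ := ∏ k, t (a k)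

theorem weight_snoc₂ {m N : ℕ} (h : m + 2 = N) (t : Fin n → Fˣ) (a : Fin m → Fin n)
    (i j : Fin n) : weight t (snoc₂ h a i j) = weight t a * t i * t j := by
  subst h
  simp [weight, snoc₂, Fin.prod_univ_add, mul_assoc]

theorem plucker₃_torus {m N : ℕ} (h : m + 2 = N) (ρ : (Fin N → Fin n) → F) (c : Fˣ)
    (t : Fin n → Fˣ) (a : Fin m → Fin n) (i j k l : Fin n) :
    plucker₃ h (fun b => ((c * weight t b : Fˣ) : F) * ρ b) a i j k l =
      MonoidAlgebra.single (c * c * weight t a * weight t a * t i * t j * t k * t l) 1 *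
        plucker₃ h ρ a i j k l := by
  rw [plucker₃, plucker₃, mul_add, mul_add, single_mul_formal, single_mul_formal,
    single_mul_formal]
  congr 1
  · congr 1
    · refine congrArg formal ?_
      simp only [weight_snoc₂, Units.val_mul]
      ac_rfl
    · refine congrArg formal ?_
      simp only [weight_snoc₂, Units.val_mul]
      ac_rfl
  · refine congrArg formal ?_
    simp only [weight_snoc₂, Units.val_mul]
    ac_rfl

/-- The action of `(c, t)`, for `c ∈ Fˣ` and `t ∈ (Fˣ)ⁿ`, on weak representations. -/
noncomputable instance : SMul (Fˣ × (Fin n → Fˣ)) (WeakRep J F) where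
  smul p ρ :=
    { toFun := fun a => ((p.1 * weight p.2 a : Fˣ) : F) * ρ a
      isUnit_iff := fun a => by
        rw [← ρ.isUnit_iff, Units.isUnit_units_mul]
      comp_perm := fun a σ => by
        have : weight p.2 (a ∘ σ) = weight p.2 a := Equiv.prod_comp σ fun k => p.2 (a k)
        rw [ρ.comp_perm, this, mul_left_comm]
      plucker := fun m h a i j k l hw => by
        rw [plucker₃_torus]
        exact Ideal.mul_mem_left _ _ (ρ.plucker m h a i j k l hw) }

theorem smul_apply (p : Fˣ × (Fin n → Fˣ)) (ρ : WeakRep J F) (a : Fin J.effRank → Fin n) :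
    (p • ρ) a = ((p.1 * weight p.2 a : Fˣ) : F) * ρ a := rfl

noncomputable instance : MulAction (Fˣ × (Fin n → Fˣ)) (WeakRep J F) where
  one_smul ρ := by
    ext a
    simp [smul_apply, weight]
  mul_smul p q ρ := by
    ext a
    simp only [smul_apply, weight, Prod.fst_mul, Prod.snd_mul, Pi.mul_apply,
      Finset.prod_mul_distrib, Units.val_mul]
    ac_rfl

/-- The action of `Fˣ` on weak representations by scalar multiplication. -/
noncomputable instance : MulAction Fˣ (WeakRep J F) :=
  MulAction.compHom _ (MonoidHom.inl Fˣ (Fin n → Fˣ))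

/-- The action of the torus `T(F) = (Fˣ)ⁿ` on weak representations. -/
noncomputable instance : MulAction (Fin n → Fˣ) (WeakRep J F) :=
  MulAction.compHom _ (MonoidHom.inr Fˣ (Fin n → Fˣ))

instance : SMulCommClass (Fin n → Fˣ) Fˣ (WeakRep J F) where
  smul_comm t c ρ := by
    change (MonoidHom.inr Fˣ (Fin n → Fˣ) t) • (MonoidHom.inl Fˣ (Fin n → Fˣ) c) • ρ =
      (MonoidHom.inl Fˣ (Fin n → Fˣ) c) • (MonoidHom.inr Fˣ (Fin n → Fˣ) t) • ρ
    rw [smul_smul, smul_smul, mul_comm]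

theorem map_smul {F₂ : Type v} [Tract F₂] (f : TractHom F F₂) (p : Fˣ × (Fin n → Fˣ))
    (ρ : WeakRep J F) :
    (p • ρ).map f = ((f.units p.1, fun i => f.units (p.2 i)) : F₂ˣ × (Fin n → F₂ˣ)) • ρ.map f := by
  ext a
  change f ((p • ρ) a) = _ * f (ρ a)
  rw [smul_apply]
  refine (map_mul f.toMonoidWithZeroHom _ _).trans ?_
  congr 1
  have : weight (fun i => f.units (p.2 i)) a = f.units (weight p.2 a) :=
    (map_prod f.units _ _).symm
  dsimp only
  rw [this, ← map_mul]
  rfl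

end WeakRep

/-! ## Thin Schubert cells and realization spaces -/

section Spaces

variable {n r : ℕ} (J : MConvexSet n r)

/-- The weak thin Schubert cell: weak representations modulo `Fˣ`. -/
def Gr (F : Type u) [Tract F] : Type u := MulAction.orbitRel.Quotient Fˣ (WeakRep J F)

/-- The realization space: weak representations modulo `Fˣ × (Fˣ)ⁿ`. -/
def RealizationSpace (F : Type u) [Tract F] : Type u :=
  MulAction.orbitRel.Quotient (Fˣ × (Fin n → Fˣ)) (WeakRep J F)

variable {J} {F : Type u} [Tract F] {F₂ : Type v} [Tract F₂]

/-- The class of a weak representation in the weak thin Schubert cell. -/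
noncomputable def Gr.mk (ρ : WeakRep J F) : Gr J F := Quotient.mk _ ρ

/-- The class of a weak representation in the realization space. -/
noncomputable def RealizationSpace.mk (ρ : WeakRep J F) : RealizationSpace J F := Quotient.mk _ ρ

/-- The push-forward `Gr(F) → Gr(F₂)`. -/
noncomputable def Gr.map (f : TractHom F F₂) : Gr J F → Gr J F₂ :=
  Quotient.map (WeakRep.map f) (by
    rintro _ ρ ⟨c, rfl⟩
    refine ⟨f.units c, ?_⟩
    refine Eq.trans ?_ (WeakRep.map_smul f (MonoidHom.inl Fˣ (Fin n → Fˣ) c) ρ).symm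
    change (MonoidHom.inl F₂ˣ (Fin n → F₂ˣ) (f.units c)) • ρ.map f = _
    congr 1
    refine Prod.ext rfl ?_
    funext i
    exact (map_one f.units).symm)

/-- The push-forward between realization spaces. -/
noncomputable def RealizationSpace.map (f : TractHom F F₂) :
    RealizationSpace J F → RealizationSpace J F₂ :=
  Quotient.map (WeakRep.map f) (by
    rintro _ ρ ⟨p, rfl⟩
    exact ⟨_, (WeakRep.map_smul f p ρ).symm⟩)

/-- The action of the torus `T(F) = (Fˣ)ⁿ` on the weak thin Schubert cell. -/
noncomputable instance : MulAction (Fin n → Fˣ) (Gr J F) where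
  smul t := Quotient.map (t • ·) (by
    rintro _ ρ ⟨c, rfl⟩
    exact ⟨c, (smul_comm t c ρ).symm⟩)
  one_smul := by
    rintro ⟨ρ⟩
    exact congrArg Gr.mk (one_smul _ ρ)
  mul_smul t t' := by
    rintro ⟨ρ⟩
    exact congrArg Gr.mk (mul_smul t t' ρ)

variable (J) in
/-- The lineality space of the thin Schubert cell over an idempotent tract: the torus orbit of the
class of the trivial representation. -/
noncomputable def lineality (h : IsIdempotent F) : Set (Gr J F) :=
  MulAction.orbit (Fin n → Fˣ) (Gr.mk (WeakRep.trivial J h))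

end Spaces

/-! ## The universal pasture and the foundation -/

namespace MConvexSet

variable {n r : ℕ} (J : MConvexSet n r)

open Classical in
/-- The variable `x_a`, which is zero by convention if `Σ a` is not in the reduction. -/
noncomputable def var (a : Fin J.effRank → Fin n) : FreeAlgebra RegularPartialField J.Tuples :=
  if h : content a ∈ J.reduction then (FreeAlgebra.X (⟨a, h⟩ : J.Tuples) :
    (FreeAlgebra RegularPartialField J.Tuples)ˣ) else 0

/-- The defining relations of the extended universal pasture: the `3`-term Plücker relations and
the alternating relations `x_{a ∘ σ} = sign(σ) x_a`. -/
def relations : Set (MonoidAlgebra ℕ (FreeAlgebra RegularPartialField J.Tuples)ˣ) :=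
  {s | ∃ (m : ℕ) (h : m + 2 = J.effRank) (a : Fin m → Fin n) (i j k l : Fin n),
    content a + basisVec i + basisVec j + basisVec k + basisVec l ≤ J.width ∧
      s = plucker₃ h J.var a i j k l} ∪
  {s | ∃ (a : Fin J.effRank → Fin n) (σ : Equiv.Perm (Fin J.effRank)),
    s = formal (J.var (a ∘ σ)) + formal (((Tract.negOne *
      signIn (FreeAlgebra RegularPartialField J.Tuples) σ : (FreeAlgebra _ _)ˣ) :
        FreeAlgebra RegularPartialField J.Tuples) * J.var a)}

theorem var_eq_zero_iff (a : Fin J.effRank → Fin n) :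
    J.var a = 0 ↔ content a ∉ J.reduction := by
  unfold var
  split_ifs with h
  · simp [h]
  · simp [h]

theorem plucker₃_ne_single {F : Type u} [Tract F] (ρ : (Fin J.effRank → Fin n) → F)
    (hρ : ∀ a, ρ a = 0 ↔ content a ∉ J.reduction) {m : ℕ} (h : m + 2 = J.effRank)
    (a : Fin m → Fin n) (i j k l : Fin n) (u : Fˣ) :
    MonoidAlgebra.single u 1 ≠ plucker₃ h ρ a i j k l := by
  classical
  intro hs
  have := congrArg mass hs
  have key := J.exchange₃ (content a) i j k l
  simp only [plucker₃, mass_single, map_add, mass_formal, mul_eq_zero, hρ,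
    content_snoc₂, Units.ne_zero, false_or] at this
  dsimp only at key
  obtain ⟨A, hA⟩ : ∃ P : Prop, P = (content a + basisVec i + basisVec j ∈ J.reduction) :=
    ⟨_, rfl⟩
  obtain ⟨A', hA'⟩ : ∃ P : Prop, P = (content a + basisVec k + basisVec l ∈ J.reduction) :=
    ⟨_, rfl⟩
  obtain ⟨B, hB⟩ : ∃ P : Prop, P = (content a + basisVec i + basisVec k ∈ J.reduction) :=
    ⟨_, rfl⟩
  obtain ⟨B', hB'⟩ : ∃ P : Prop, P = (content a + basisVec j + basisVec l ∈ J.reduction) :=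
    ⟨_, rfl⟩
  obtain ⟨C, hC⟩ : ∃ P : Prop, P = (content a + basisVec i + basisVec l ∈ J.reduction) :=
    ⟨_, rfl⟩
  obtain ⟨C', hC'⟩ : ∃ P : Prop, P = (content a + basisVec j + basisVec k ∈ J.reduction) :=
    ⟨_, rfl⟩
  simp only [← hA, ← hA', ← hB, ← hB', ← hC, ← hC'] at key this
  clear hA hA' hB hB' hC hC' hs
  by_cases A <;> by_cases A' <;> by_cases B <;> by_cases B' <;> by_cases C <;> by_cases C' <;>
    simp_all

theorem alternating_ne_single {F : Type u} [Tract F] (ρ : (Fin J.effRank → Fin n) → F)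
    (hρ : ∀ a, ρ a = 0 ↔ content a ∉ J.reduction) (a : Fin J.effRank → Fin n)
    (σ : Equiv.Perm (Fin J.effRank)) (v u : Fˣ) :
    MonoidAlgebra.single u 1 ≠ formal (ρ (a ∘ σ)) + formal ((v : F) * ρ a) := by
  classical
  intro hs
  have := congrArg mass hs
  simp only [mass_single, map_add, mass_formal, mul_eq_zero, hρ, content_comp,
    Units.ne_zero, false_or] at this
  split_ifs at this <;> omega

theorem single_notMem_relations (u : (FreeAlgebra RegularPartialField J.Tuples)ˣ) :
    MonoidAlgebra.single u 1 ∉ J.relations := by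
  rintro (⟨m, h, a, i, j, k, l, -, hs⟩ | ⟨a, σ, hs⟩)
  · exact J.plucker₃_ne_single J.var J.var_eq_zero_iff h a i j k l u hs
  · exact J.alternating_ne_single J.var J.var_eq_zero_iff a σ _ u hs

/-- The extended universal pasture of `J`. -/
abbrev ExtPasture : Type :=
  TractQuotient (FreeAlgebra RegularPartialField J.Tuples) J.relations J.single_notMem_relations

/-- The universal weak representation `a ↦ x_a`, as a function. -/
noncomputable def univRep (a : Fin J.effRank → Fin n) : J.ExtPasture :=
  TractQuotient.mk (J.var a)

/-- The homomorphism on the units of the free algebra that maps `x_a` to `d a`. -/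
noncomputable def degAux {A : Type*} [AddCommGroup A] (d : J.Tuples → A) :
    (FreeAlgebra RegularPartialField J.Tuples)ˣ →* Multiplicative A :=
  (AddMonoidHom.toMultiplicative (Finsupp.liftAddHom fun b =>
    (AddMonoidHom.flip (smulAddHom ℤ A)) (d b))).comp FreeAlgebra.exponents

theorem degAux_X {A : Type*} [AddCommGroup A] (d : J.Tuples → A) (b : J.Tuples) :
    J.degAux d (FreeAlgebra.X b) = Multiplicative.ofAdd (d b) := by
  simp [degAux, FreeAlgebra.exponents_X]

theorem degAux_negOne {A : Type*} [AddCommGroup A] (d : J.Tuples → A) :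
    J.degAux d Tract.negOne = 1 := by
  simp [degAux, FreeAlgebra.exponents_negOne]

theorem coeff_formal_unit_mul {F : Type u} [CommGroupWithZero F] {v u : Fˣ} {a : F}
    (h : (formal ((v : F) * a)).coeff u ≠ 0) : ∃ w : Fˣ, a = w ∧ u = v * w := by
  have h' := coeff_formal_ne_zero h
  refine ⟨v⁻¹ * u, ?_, by simp⟩
  rw [Units.val_mul, ← h', Units.inv_mul_cancel_left]

/-- A homomorphism that vanishes on `-1` and is constant on the terms of each element of `S`
vanishes on the relations defined by `S`. -/
theorem relSubgroup_le_ker {F : Type u} [Tract F] {S : Set (MonoidAlgebra ℕ Fˣ)} {A : Type v}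
    [CommGroup A] (d : Fˣ →* A) (hd : d Tract.negOne = 1)
    (hS : ∀ s ∈ S, ∃ D, ∀ u, s.coeff u ≠ 0 → d u = D) : relSubgroup S ≤ d.ker := by
  rw [relSubgroup, Subgroup.closure_le]
  rintro _ ⟨a, b, hab, rfl⟩
  obtain ⟨D, hD⟩ := hS _ hab
  have h₁ := hD a (by
    classical
    simp only [MonoidAlgebra.coeff_add, MonoidAlgebra.coeff_single, Finsupp.add_apply,
      Finsupp.single_apply]
    simp)
  have h₂ := hD (Tract.negOne * b) (by
    classical
    simp only [MonoidAlgebra.coeff_add, MonoidAlgebra.coeff_single, Finsupp.add_apply,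
      Finsupp.single_apply]
    simp)
  rw [map_mul, hd, one_mul] at h₂
  simp [h₁, h₂]

theorem plucker₃_homogeneous {F : Type u} [Tract F] {A : Type v} [CommGroup A] (d : Fˣ →* A)
    (hd : d Tract.negOne = 1) (ρ : (Fin J.effRank → Fin n) → F)
    (g : Multiplicative (Fin n → ℕ) →* A) (c : A)
    (hρ : ∀ b (u : Fˣ), ρ b = u → d u = c * g (Multiplicative.ofAdd (content b)))
    {m : ℕ} (h : m + 2 = J.effRank) (a : Fin m → Fin n) (i j k l : Fin n) (u : Fˣ)
    (hu : (plucker₃ h ρ a i j k l).coeff u ≠ 0) :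
    d u = c * c * g (Multiplicative.ofAdd (content a + content a + basisVec i + basisVec j +
      basisVec k + basisVec l)) := by
  have two : ∀ b b' (w : Fˣ), ρ b * ρ b' = w → d w = c * c * g (Multiplicative.ofAdd
      (content b + content b')) := by
    intro b b' w hw
    have hb : ρ b ≠ 0 := fun e => w.ne_zero (by rw [← hw, e, zero_mul])
    have hb' : ρ b' ≠ 0 := fun e => w.ne_zero (by rw [← hw, e, mul_zero])
    have e : w = Units.mk0 _ hb * Units.mk0 _ hb' := Units.ext hw.symm
    rw [e, map_mul, hρ b _ rfl, hρ b' _ rfl, ofAdd_add, map_mul]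
    exact mul_mul_mul_comm _ _ _ _
  have h3 : (formal (ρ (snoc₂ h a i j) * ρ (snoc₂ h a k l))).coeff u ≠ 0 ∨
      (formal (((Tract.negOne : Fˣ) : F) * (ρ (snoc₂ h a i k) * ρ (snoc₂ h a j l)))).coeff u ≠ 0 ∨
      (formal (ρ (snoc₂ h a i l) * ρ (snoc₂ h a j k))).coeff u ≠ 0 := by
    by_contra hcon
    push Not at hcon
    apply hu
    simp only [plucker₃, MonoidAlgebra.coeff_add, Finsupp.add_apply, hcon]
  rcases h3 with h3 | h3 | h3
  · rw [two _ _ u (coeff_formal_ne_zero h3), content_snoc₂, content_snoc₂]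
    congr 3
    ac_rfl
  · obtain ⟨w, hw, rfl⟩ := coeff_formal_unit_mul h3
    rw [map_mul, hd, one_mul, two _ _ w hw, content_snoc₂, content_snoc₂]
    congr 3
    ac_rfl
  · rw [two _ _ u (coeff_formal_ne_zero h3), content_snoc₂, content_snoc₂]
    congr 3
    ac_rfl

theorem alternating_homogeneous {F : Type u} [Tract F] {A : Type v} [CommGroup A] (d : Fˣ →* A)
    (hd : d Tract.negOne = 1) (ρ : (Fin J.effRank → Fin n) → F)
    (g : Multiplicative (Fin n → ℕ) →* A) (c : A)
    (hρ : ∀ b (u : Fˣ), ρ b = u → d u = c * g (Multiplicative.ofAdd (content b)))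
    (a : Fin J.effRank → Fin n) (σ : Equiv.Perm (Fin J.effRank)) (u : Fˣ)
    (hu : (formal (ρ (a ∘ σ)) + formal (((Tract.negOne * signIn F σ : Fˣ) : F) * ρ a)).coeff u ≠
      0) : d u = c * g (Multiplicative.ofAdd (content a)) := by
  have h3 : (formal (ρ (a ∘ σ))).coeff u ≠ 0 ∨
      (formal (((Tract.negOne * signIn F σ : Fˣ) : F) * ρ a)).coeff u ≠ 0 := by
    by_contra hcon
    push Not at hcon
    apply hu
    simp only [MonoidAlgebra.coeff_add, Finsupp.add_apply, hcon]
  rcases h3 with h3 | h3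
  · rw [hρ _ u (coeff_formal_ne_zero h3), content_comp]
  · obtain ⟨w, hw, rfl⟩ := coeff_formal_unit_mul h3
    have hs : d (signIn F σ) = 1 := by
      unfold signIn
      split_ifs
      · exact map_one d
      · exact hd
    rw [map_mul, map_mul, hd, hs, one_mul, one_mul, hρ _ w hw]

theorem degAux_le_ker {A : Type*} [AddCommGroup A] (g : (Fin n → ℕ) →+ A) (c : A) :
    relSubgroup J.relations ≤ (J.degAux fun b => c + g (content b.1)).ker := by
  have hρ : ∀ b (u : (FreeAlgebra RegularPartialField J.Tuples)ˣ), J.var b = u →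
      J.degAux (fun b => c + g (content b.1)) u =
        Multiplicative.ofAdd c * g.toMultiplicative (Multiplicative.ofAdd (content b)) := by
    intro b u hu
    unfold var at hu
    split_ifs at hu with h
    · rw [← Units.ext hu, degAux_X]
      rfl
    · exact absurd hu.symm u.ne_zero
  refine relSubgroup_le_ker _ (J.degAux_negOne _) ?_
  rintro _ (⟨m, h, a, i, j, k, l, -, rfl⟩ | ⟨a, σ, rfl⟩)
  · exact ⟨_, fun u hu => J.plucker₃_homogeneous _ (J.degAux_negOne _) J.var _ _ hρ h a i j k l
      u hu⟩
  · exact ⟨_, fun u hu => J.alternating_homogeneous _ (J.degAux_negOne _) J.var _ _ hρ a σ u hu⟩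

/-- The degree on the units of the extended universal pasture, with `deg x_a = 1`. -/
noncomputable def deg : J.ExtPastureˣ →* Multiplicative ℤ :=
  TractQuotient.unitsLift (J.degAux fun b => 1 + (0 : (Fin n → ℕ) →+ ℤ) (content b.1))
    (J.degAux_le_ker 0 1)

/-- The inclusion of `ℕⁿ` into `ℤⁿ`. -/
def castHom (n : ℕ) : (Fin n → ℕ) →+ (Fin n → ℤ) where
  toFun α i := α i
  map_zero' := by
    funext i
    simp
  map_add' α β := by
    funext i
    simp

/-- The multidegree on the units of the extended universal pasture, with value `Σ a` at `x_a`. -/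
noncomputable def multideg : J.ExtPastureˣ →* Multiplicative (Fin n → ℤ) :=
  TractQuotient.unitsLift (J.degAux fun b => 0 + castHom n (content b.1))
    (J.degAux_le_ker (castHom n) 0)

theorem deg_negOne : Tract.negOne ∈ J.deg.ker :=
  MonoidHom.mem_ker.mpr <| (TractQuotient.unitsLift_negOne _ _).trans (J.degAux_negOne _)

theorem multideg_negOne : Tract.negOne ∈ J.multideg.ker :=
  MonoidHom.mem_ker.mpr <| (TractQuotient.unitsLift_negOne _ _).trans (J.degAux_negOne _)

/-- The universal pasture of `J`: the elements of degree `0` in the extended universal pasture. -/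
abbrev UnivPasture : Type := Subtract J.ExtPasture J.deg.ker J.deg_negOne

/-- The foundation of `J`: the elements of degree `0` and multidegree `0` in the extended universal
pasture. -/
abbrev Foundation : Type :=
  Subtract J.ExtPasture (J.deg.ker ⊓ J.multideg.ker)
    (Subgroup.mem_inf.mpr ⟨J.deg_negOne, J.multideg_negOne⟩)

/-- The inclusion of the universal pasture into the extended universal pasture. -/
noncomputable def univIncl : TractHom J.UnivPasture J.ExtPasture := Subtract.incl

/-- The inclusion of the foundation into the universal pasture. -/
noncomputable def foundationIncl : TractHom J.Foundation J.UnivPasture :=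
  Subtract.inclusion inf_le_left

end MConvexSet

end PolyTract

namespace PolyTract

/-! Everything is governed by one equivalence relation on the ground set: `Adjacent` joins i and j
when J contains α and β with α + ε_i = β + ε_j, and the components are the classes of the relation
it generates.

Exchange steps stay inside one component. Hence the coordinate sum over a union of components is
constant on J, and two vectors of J can be glued along such a union (`IsMConvex.exists_glue`), so J
is the direct sum of its restrictions to the components. Conversely, the coordinate sum over a block
of any direct sum is constant on J, so adjacent elements lie in one block. The decompositions are
therefore exactly the enumerations of the components
(`IsMConvex.isIndecomposableDecomposition_iff`), and c(J) is the number of components.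

A torus element t fixes [ρ] if and only if t^{Σa} does not depend on the tuple a with ρ(a) ≠ 0.
Comparing adjacent vectors, this means that t is constant on components
(`MConvexSet.monomial_content_eq_iff`), whatever ρ is. With a representative chosen in each
component, the stabilizer is the kernel of the surjection `torusHom`, t ↦ (t_i / t_{rep i}), where i
runs over the n - c(J) non-representatives. Every orbit, in particular the lineality space, is thus
identified with the target of `torusHom`.

A weak representation satisfies precisely the relations of the extended universal pasture, which
gives f_ρ. On the units of the universal pasture, the multidegree has the units of the foundation as
kernel. Its image is the free group on the ε_i - ε_{rep i}: these are multidegrees of products of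
ratios x_b / x_a and their inverses, and the multidegree of an element of degree 0 sums to zero over
each component (`torusChar_univIncl`). So the unit group splits. For the null sets, all relations
are homogeneous, hence the null set of the extended pasture is generated by that of the foundation
(`null_extPasture_le`); a linear projection of group semirings transfers this to the universal
pasture (`comap_map_le`).

Finally, the values of f_ρ at the free generators are coordinates on the thin Schubert cell. Scalars
do not change them, and t multiplies them by `torusHom` of t, so they parametrize each fibre of the
map to the realization space. -/

theorem eqOn_of_sum_eq {ι : Type*} {α β : ι → ℕ} {A : Finset ι} (h : ∑ x ∈ A, α x = ∑ x ∈ A, β x)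
    (hle : ∀ x ∈ A, β x ≤ α x) : ∀ x ∈ A, α x = β x := fun x hx =>
  ((Finset.sum_eq_sum_iff_of_le hle).mp h.symm x hx).symm

/-! ### Connected components and direct sum decompositions -/

section Connectivity

variable {ι : Type*} [DecidableEq ι] {J : Set (ι → ℕ)} {r : ℕ}

theorem basisVec_self (i : ι) : basisVec i i = 1 := by simp [basisVec]

theorem basisVec_of_ne {i x : ι} (h : x ≠ i) : basisVec i x = 0 := by simp [basisVec, h]

theorem sum_basisVec (A : Finset ι) (i : ι) : ∑ x ∈ A, basisVec i x = if i ∈ A then 1 else 0 := by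
  simp [basisVec, Pi.single_apply]

theorem basisVec_subtype {p : ι → Prop} [DecidablePred p] (i x : {j // p j}) :
    basisVec i x = basisVec i.1 x.1 := by
  simp [basisVec, Pi.single_apply, Subtype.ext_iff]

/-- Two elements `i`, `j` of the ground set are adjacent if `J` contains two vectors that differ
by `ε_i - ε_j`. -/
def Adjacent (J : Set (ι → ℕ)) (i j : ι) : Prop :=
  ∃ α ∈ J, ∃ β ∈ J, α + basisVec i = β + basisVec j

/-- The equivalence relation generated by adjacency. -/
def connSetoid (J : Set (ι → ℕ)) : Setoid ι := Relation.EqvGen.setoid (Adjacent J)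

theorem eq_of_conn {X : Type*} {κ : ι → X} (h : ∀ i j, Adjacent J i j → κ i = κ j) {i j : ι}
    (hij : connSetoid J i j) : κ i = κ j := by
  induction hij with
  | rel i j hij => exact h i j hij
  | refl => rfl
  | symm _ _ _ ih => exact ih.symm
  | trans _ _ _ _ _ ih₁ ih₂ => exact ih₁.trans ih₂

/-- A step from `α` towards `β` on a set containing both coordinates decreases the distance. -/
theorem sum_tsub_lt_of_step {α β γ : ι → ℕ} {i j : ι} (hi : α i < β i) (hj : β j < α j)
    (h : γ + basisVec j = α + basisVec i) (A : Finset ι) (hiA : i ∈ A) :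
    ∑ x ∈ A, (β x - γ x) < ∑ x ∈ A, (β x - α x) := by
  have hij : i ≠ j := by
    rintro rfl
    omega
  have hx : ∀ x, γ x + basisVec j x = α x + basisVec i x := fun x => congrFun h x
  refine Finset.sum_lt_sum (fun x _ => ?_) ⟨i, hiA, ?_⟩
  · have := hx x
    by_cases hxj : x = j
    · subst hxj
      rw [basisVec_self, basisVec_of_ne hij.symm] at this
      omega
    · rw [basisVec_of_ne hxj] at this
      omega
  · have := hx i
    rw [basisVec_self, basisVec_of_ne hij] at this
    omega

variable [Fintype ι]

/-- Since β j < α j, the truncated subtraction of ε_j in the exchange axiom is a true one, and the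
step can be written additively. Only the vector near α is kept. -/
theorem IsMConvex.exists_step (hJ : IsMConvex r J) {α β : ι → ℕ} (hα : α ∈ J) (hβ : β ∈ J) {i : ι}
    (hi : α i < β i) : ∃ j, β j < α j ∧ ∃ γ ∈ J, γ + basisVec j = α + basisVec i := by
  obtain ⟨j, hj, h, -⟩ := hJ.exchange α hα β hβ i hi
  refine ⟨j, hj, _, h, ?_⟩
  funext x
  simp only [basisVec, Pi.add_apply, Pi.sub_apply, Pi.single_apply]
  rcases eq_or_ne x j with rfl | hx <;> split_ifs <;> omega

/-- A function on an M-convex set that is invariant under exchange steps is constant. -/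
theorem IsMConvex.eq_of_step_invariant (hJ : IsMConvex r J) {X : Type*} (f : (ι → ℕ) → X)
    (hf : ∀ α ∈ J, ∀ β ∈ J, ∀ i j, α + basisVec i = β + basisVec j → f α = f β) {α β : ι → ℕ}
    (hα : α ∈ J) (hβ : β ∈ J) : f α = f β := by
  induction hd : ∑ x, (β x - α x) using Nat.strong_induction_on generalizing α with
  | _ d ih =>
    by_cases hlt : ∃ i, α i < β i
    · obtain ⟨i, hi⟩ := hlt
      obtain ⟨j, hj, γ, hγ, h⟩ := hJ.exists_step hα hβ hi
      rw [hf α hα γ hγ i j h.symm]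
      exact ih _ (hd ▸ sum_tsub_lt_of_step hi hj h Finset.univ (Finset.mem_univ i)) hγ rfl
    · push Not at hlt
      have : α = β := funext fun x => eqOn_of_sum_eq (A := Finset.univ)
        ((hJ.sum_eq α hα).trans (hJ.sum_eq β hβ).symm) (fun x _ => hlt x) x (Finset.mem_univ x)
      rw [this]

/-- The two indices of an exchange step are adjacent, so A contains both or neither, and the step
preserves the sum over A. -/
theorem IsMConvex.sum_eq_of_closed (hJ : IsMConvex r J) {A : Finset ι}
    (hA : ∀ i j, Adjacent J i j → (i ∈ A ↔ j ∈ A)) {α β : ι → ℕ} (hα : α ∈ J) (hβ : β ∈ J) :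
    ∑ x ∈ A, α x = ∑ x ∈ A, β x := by
  refine hJ.eq_of_step_invariant (fun α => ∑ x ∈ A, α x) (fun α hα β hβ i j h => ?_) hα hβ
  have h' := congrArg (fun δ : ι → ℕ => ∑ x ∈ A, δ x) h
  simp only [Pi.add_apply, Finset.sum_add_distrib, sum_basisVec,
    hA i j ⟨α, hα, β, hβ, h⟩] at h'
  exact Nat.add_right_cancel h'

/-- Two vectors of an M-convex set can be glued along a union of connected components. -/
theorem IsMConvex.exists_glue (hJ : IsMConvex r J) {A : Finset ι}
    (hA : ∀ i j, Adjacent J i j → (i ∈ A ↔ j ∈ A)) {α β : ι → ℕ} (hα : α ∈ J) (hβ : β ∈ J) :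
    ∃ γ ∈ J, (∀ x ∈ A, γ x = β x) ∧ ∀ x ∉ A, γ x = α x := by
  induction hd : ∑ x ∈ A, (β x - α x) using Nat.strong_induction_on generalizing α with
  | _ d ih =>
    by_cases hlt : ∃ i ∈ A, α i < β i
    · obtain ⟨i, hiA, hi⟩ := hlt
      obtain ⟨j, hj, γ, hγ, h⟩ := hJ.exists_step hα hβ hi
      -- The index that pays for the increase at i is adjacent to i, so the step leaves the
      -- coordinates outside A untouched.
      have hjA : j ∈ A := (hA i j ⟨α, hα, γ, hγ, h.symm⟩).mp hiA
      obtain ⟨δ, hδ, h₁, h₂⟩ := ih _ (hd ▸ sum_tsub_lt_of_step hi hj h A hiA) hγ rfl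
      refine ⟨δ, hδ, h₁, fun x hx => (h₂ x hx).trans ?_⟩
      have := congrFun h x
      rwa [Pi.add_apply, Pi.add_apply, basisVec_of_ne (by rintro rfl; exact hx hjA),
        basisVec_of_ne (by rintro rfl; exact hx hiA)] at this
    · push Not at hlt
      exact ⟨α, hα, eqOn_of_sum_eq (hJ.sum_eq_of_closed hA hα hβ) hlt, fun _ _ => rfl⟩

/-- The restrictions of the vectors of `J` to a fibre of `κ`. -/
def restrictFibre (J : Set (ι → ℕ)) {m : ℕ} (κ : ι → Fin m) (b : Fin m) :
    Set ({j : ι // κ j = b} → ℕ) :=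
  (fun α j => α j.1) '' J

/-- Fibres of κ are unions of components, so vectors of J can be glued along them. Gluing yields
both the exchange axiom in a fibre and the product description of J. -/
theorem IsMConvex.isDirectSum_restrictFibre (hJ : IsMConvex r J) {m : ℕ} {κ : ι → Fin m}
    (hκ : ∀ i j, Adjacent J i j → κ i = κ j) : IsDirectSum J κ (restrictFibre J κ) := by
  have closed : ∀ S : Finset (Fin m), ∀ i j, Adjacent J i j →
      (i ∈ Finset.univ.filter (κ · ∈ S) ↔ j ∈ Finset.univ.filter (κ · ∈ S)) := by
    intro S i j h
    simp [hκ i j h]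
  refine ⟨fun b => ?_, Set.ext fun α => ⟨fun hα b => ⟨α, hα, rfl⟩, fun hα => ?_⟩⟩
  · obtain ⟨α₀, hα₀⟩ := hJ.nonempty
    refine ⟨∑ j : {j // κ j = b}, α₀ j.1, ⟨_, α₀, hα₀, rfl⟩, ?_, ?_⟩
    · rintro _ ⟨α, hα, rfl⟩
      have := hJ.sum_eq_of_closed (closed {b}) hα hα₀
      simp only [Finset.mem_singleton] at this
      rwa [← Finset.sum_subtype_eq_sum_filter, ← Finset.sum_subtype_eq_sum_filter,
        Finset.subtype_univ] at this
    · rintro _ ⟨α, hα, rfl⟩ _ ⟨β', hβ', rfl⟩ i hi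
      -- β agrees with β' on the fibre and with α off it. An index j with β j < α j must then lie in
      -- the fibre, so exchange in J restricts to exchange in the fibre.
      obtain ⟨β, hβ, h₁, h₂⟩ := hJ.exists_glue (closed {b}) hα hβ'
      simp only [Finset.mem_singleton, Finset.mem_filter, Finset.mem_univ, true_and] at h₁ h₂
      have e : (fun j : {j // κ j = b} => β' j.1) = fun j => β j.1 :=
        funext fun j => (h₁ j.1 j.2).symm
      change ∃ j : {j // κ j = b}, β' j.1 < α j.1 ∧ (fun j => α j.1) + basisVec i - basisVec j ∈ _ ∧
        (fun j => β' j.1) - basisVec i + basisVec j ∈ _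
      change α i.1 < β' i.1 at hi
      rw [← h₁ i.1 i.2] at hi
      simp only [e]
      obtain ⟨j, hj, hj₁, hj₂⟩ := hJ.exchange α hα β hβ i.1 hi
      have hjb : κ j = b := by
        by_contra hne
        rw [h₂ j hne] at hj
        exact lt_irrefl _ hj
      refine ⟨⟨j, hjb⟩, (h₁ j hjb).symm.trans_lt hj, ⟨_, hj₁, ?_⟩, ⟨_, hj₂, ?_⟩⟩ <;>
      · funext x
        simp only [Pi.add_apply, Pi.sub_apply, basisVec_subtype]
  -- A vector whose restrictions are all realized in J is assembled by gluing one fibre after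
  -- another.
  · have key : ∀ S : Finset (Fin m), ∃ γ ∈ J, ∀ x, κ x ∈ S → γ x = α x := by
      intro S
      induction S using Finset.induction_on with
      | empty =>
        obtain ⟨γ, hγ⟩ := hJ.nonempty
        exact ⟨γ, hγ, by simp⟩
      | insert b S _ ih =>
        obtain ⟨γ, hγ, h⟩ := ih
        obtain ⟨β, hβ, hb⟩ := hα b
        obtain ⟨δ, hδ, h₁, h₂⟩ := hJ.exists_glue (closed {b}) hγ hβ
        simp only [Finset.mem_singleton, Finset.mem_filter, Finset.mem_univ, true_and] at h₁ h₂
        refine ⟨δ, hδ, fun x hx => ?_⟩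
        by_cases hxb : κ x = b
        · exact (h₁ x hxb).trans (congrFun hb ⟨x, hxb⟩)
        · exact (h₂ x hxb).trans (h x ((Finset.mem_insert.mp hx).resolve_left hxb))
    obtain ⟨γ, hγ, h⟩ := key Finset.univ
    rwa [← funext fun x => h x (Finset.mem_univ _)]

/-- The coordinate sum over the block of i is constant on J, whereas adding ε_i - ε_j would change
it if j lay in another block. -/
theorem IsDirectSum.eq_of_adjacent {m : ℕ} {κ : ι → Fin m}
    {K : ∀ b : Fin m, Set ({j : ι // κ j = b} → ℕ)} (h : IsDirectSum J κ K) {i j : ι}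
    (hij : Adjacent J i j) : κ i = κ j := by
  obtain ⟨α, hα, β, hβ, e⟩ := hij
  obtain ⟨r, hr⟩ := h.1 (κ i)
  rw [h.2] at hα hβ
  have hsum := (hr.sum_eq _ (hα (κ i))).trans (hr.sum_eq _ (hβ (κ i))).symm
  have h' := congrArg (fun δ : ι → ℕ => ∑ x : {x // κ x = κ i}, δ x.1) e
  simp only [Pi.add_apply, Finset.sum_add_distrib, hsum, add_right_inj] at h'
  have hs : ∀ k, ∑ x : {x // κ x = κ i}, basisVec k x.1 = if κ k = κ i then 1 else 0 := by
    intro k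
    have := sum_basisVec (Finset.univ.filter (κ · = κ i)) k
    rw [← Finset.sum_subtype_eq_sum_filter, Finset.subtype_univ] at this
    simpa only [Finset.mem_filter, Finset.mem_univ, true_and] using this
  rw [hs, hs, if_pos rfl] at h'
  by_contra hne
  rw [if_neg (Ne.symm hne)] at h'
  exact one_ne_zero h'

/-- If some j is not connected to i, the component of i and its complement split J. Conversely, a
splitting map is constant on components, so it cannot be surjective onto two blocks when everything
is connected. -/
theorem IsMConvex.isIndecomposable_iff (hJ : IsMConvex r J) :
    IsIndecomposable J ↔ Nonempty ι ∧ ∀ i j, connSetoid J i j := by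
  classical
  refine and_congr_right fun _ => ⟨fun h => ?_, fun h κ K hκ hK => ?_⟩
  · by_contra hcon
    push Not at hcon
    obtain ⟨i, j, hij⟩ := hcon
    refine h (fun x => if connSetoid J i x then 0 else 1) _ ?_
      (hJ.isDirectSum_restrictFibre fun x y hxy => ?_)
    · intro b
      fin_cases b
      · exact ⟨i, if_pos ((connSetoid J).refl i)⟩
      · exact ⟨j, if_neg hij⟩
    · have hxy' : connSetoid J x y := Relation.EqvGen.rel x y hxy
      have : connSetoid J i x ↔ connSetoid J i y :=
        ⟨fun h => (connSetoid J).trans h hxy', fun h => (connSetoid J).trans h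
          ((connSetoid J).symm hxy')⟩
      simp only [this]
  · obtain ⟨i, hi⟩ := hκ 0
    obtain ⟨j, hj⟩ := hκ 1
    have := eq_of_conn (fun _ _ => hK.eq_of_adjacent) (h i j)
    rw [hi, hj] at this
    exact absurd this (by decide)

/-- Both vectors of the summand are extended by the same base vectors in the other summands, so they
still differ by ε_i - ε_j only. -/
theorem IsDirectSum.adjacent_of_adjacent {m : ℕ} {κ : ι → Fin m}
    {K : ∀ b : Fin m, Set ({j : ι // κ j = b} → ℕ)} (h : IsDirectSum J κ K) {b : Fin m}
    {i j : {j : ι // κ j = b}} (hij : Adjacent (K b) i j) : Adjacent J i.1 j.1 := by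
  obtain ⟨α, hα, β, hβ, e⟩ := hij
  choose r hr using h.1
  choose base hbase using fun b => (hr b).nonempty
  let ext (δ : {j : ι // κ j = b} → ℕ) (x : ι) : ℕ := Function.update base b δ (κ x) ⟨x, rfl⟩
  have hext : ∀ δ ∈ K b, ext δ ∈ J := by
    intro δ hδ
    rw [h.2]
    intro b'
    have : (fun x : {j : ι // κ j = b'} => ext δ x.1) = Function.update base b δ b' := by
      funext ⟨x, hx⟩
      subst hx
      rfl
    rw [this]
    by_cases hb : b' = b
    · subst hb
      rwa [Function.update_self]
    · rw [Function.update_of_ne hb]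
      exact hbase b'
  refine ⟨ext α, hext α hα, ext β, hext β hβ, funext fun x => ?_⟩
  by_cases hx : κ x = b
  · subst hx
    have := congrFun e ⟨x, rfl⟩
    simp only [Pi.add_apply, basisVec_subtype] at this
    simpa only [ext, Pi.add_apply, Function.update_self] using this
  · have hxi : x ≠ i.1 := fun e => hx (e ▸ i.2)
    have hxj : x ≠ j.1 := fun e => hx (e ▸ j.2)
    simp only [ext, Pi.add_apply, basisVec_of_ne hxi, basisVec_of_ne hxj,
      Function.update_of_ne hx]

/-- The decompositions into indecomposable components are the enumerations of the connected
components. -/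
theorem IsMConvex.isIndecomposableDecomposition_iff (hJ : IsMConvex r J) {m : ℕ}
    {κ : ι → Fin m} : IsIndecomposableDecomposition J κ ↔
      Function.Surjective κ ∧ ∀ i j, κ i = κ j ↔ connSetoid J i j := by
  constructor
  · rintro ⟨K, hK, hind⟩
    refine ⟨fun b => ?_, fun i j => ⟨fun hij => ?_, eq_of_conn fun _ _ => hK.eq_of_adjacent⟩⟩
    · obtain ⟨⟨i, hi⟩⟩ := (hind b).1
      exact ⟨i, hi⟩
    · obtain ⟨r, hr⟩ := hK.1 (κ j)
      have := (hr.isIndecomposable_iff.mp (hind (κ j))).2 ⟨i, hij⟩ ⟨j, rfl⟩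
      have key : ∀ x y, connSetoid (K (κ j)) x y → connSetoid J x.1 y.1 := by
        intro x y hxy
        induction hxy with
        | rel x y hxy => exact Relation.EqvGen.rel _ _ (hK.adjacent_of_adjacent hxy)
        | refl => exact (connSetoid J).refl _
        | symm _ _ _ ih => exact (connSetoid J).symm ih
        | trans _ _ _ _ _ ih₁ ih₂ => exact (connSetoid J).trans ih₁ ih₂
      exact key _ _ this
  · rintro ⟨hs, hκ⟩
    have hK := hJ.isDirectSum_restrictFibre (κ := κ)
      fun i j hij => (hκ i j).mpr (Relation.EqvGen.rel i j hij)
    refine ⟨_, hK, fun b => ?_⟩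
    obtain ⟨r, hr⟩ := hK.1 b
    obtain ⟨i₀, hi₀⟩ := hs b
    refine hr.isIndecomposable_iff.mpr ⟨⟨⟨i₀, hi₀⟩⟩, ?_⟩
    -- The fibre memberships are quantified inside the induction because a chain from i to j passes
    -- through further elements; these lie in the fibre since κ is constant on components.
    have key : ∀ i j, Relation.EqvGen (Adjacent J) i j → ∀ (hi : κ i = b) (hj : κ j = b),
        connSetoid (restrictFibre J κ b) ⟨i, hi⟩ ⟨j, hj⟩ := by
      intro i j hij
      induction hij with
      | rel i j hij =>
        intro hi hj
        obtain ⟨α, hα, β, hβ, e⟩ := hij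
        refine Relation.EqvGen.rel _ _ ⟨_, ⟨α, hα, rfl⟩, _, ⟨β, hβ, rfl⟩, funext fun x => ?_⟩
        simpa only [Pi.add_apply, basisVec_subtype] using congrFun e x.1
      | refl => exact fun _ _ => (connSetoid _).refl _
      | symm _ _ _ ih => exact fun hi hj => (connSetoid _).symm (ih hj hi)
      | trans i k j hik _ ih₁ ih₂ =>
        intro hi hj
        have hk : κ k = b := ((hκ i k).mpr hik).symm.trans hi
        exact (connSetoid _).trans (ih₁ hi hk) (ih₂ hk hj)
    rintro ⟨i, hi⟩ ⟨j, hj⟩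
    exact key i j ((hκ i j).mp (hi.trans hj.symm)) hi hj

theorem IsMConvex.card_eq_of_decomposition (hJ : IsMConvex r J) {m : ℕ} {κ : ι → Fin m}
    (h : IsIndecomposableDecomposition J κ) : m = Nat.card (Quotient (connSetoid J)) := by
  obtain ⟨hs, hκ⟩ := hJ.isIndecomposableDecomposition_iff.mp h
  let f : Quotient (connSetoid J) → Fin m := Quotient.lift κ fun i j hij => (hκ i j).mpr hij
  have hf : Function.Bijective f := by
    refine ⟨?_, fun b => ?_⟩
    · rintro ⟨i⟩ ⟨j⟩ hij
      exact Quotient.sound ((hκ i j).mp hij)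
    · obtain ⟨i, hi⟩ := hs b
      exact ⟨Quotient.mk _ i, hi⟩
  rw [Nat.card_eq_of_bijective f hf, Nat.card_eq_fintype_card, Fintype.card_fin]

theorem IsMConvex.exists_decomposition (hJ : IsMConvex r J) :
    ∃ κ : ι → Fin (Nat.card (Quotient (connSetoid J))), IsIndecomposableDecomposition J κ := by
  let e := Finite.equivFin (Quotient (connSetoid J))
  refine ⟨fun i => e (Quotient.mk _ i), hJ.isIndecomposableDecomposition_iff.mpr
    ⟨e.surjective.comp Quotient.mk_surjective, fun i j => ?_⟩⟩
  rw [e.injective.eq_iff, Quotient.eq]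

end Connectivity

namespace MConvexSet

variable {n r : ℕ} (J : MConvexSet n r)

/-- Existence and uniqueness of the number of blocks make the set in the definition of c(J) a
singleton, so its infimum is the number of components. -/
theorem numComponents_eq_card : J.numComponents = Nat.card (Quotient (connSetoid J.carrier)) := by
  have : {m | ∃ κ : Fin n → Fin m, IsIndecomposableDecomposition J.carrier κ} =
      {Nat.card (Quotient (connSetoid J.carrier))} := by
    ext m
    constructor
    · rintro ⟨κ, hκ⟩
      exact J.isMConvex.card_eq_of_decomposition hκ
    · rintro rfl
      exact J.isMConvex.exists_decomposition
  rw [numComponents, this, csInf_singleton]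

end MConvexSet
-- Contents of tuples and torus characters
theorem exists_content_eq {n : ℕ} (N : ℕ) (v : Fin n → ℕ) (hv : ∑ i, v i = N) :
    ∃ a : Fin N → Fin n, content a = v := by
  induction N generalizing v with
  | zero =>
    refine ⟨Fin.elim0, funext fun i => ?_⟩
    have := Finset.sum_eq_zero_iff.mp hv i (Finset.mem_univ i)
    simp [content, this]
  | succ N ih =>
    obtain ⟨i, -, hi⟩ : ∃ i ∈ Finset.univ, v i ≠ 0 := by
      by_contra hcon
      push Not at hcon
      rw [Finset.sum_eq_zero hcon] at hv
      omega
    have hvi : v - basisVec i + basisVec i = v := by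
      funext x
      simp only [basisVec, Pi.add_apply, Pi.sub_apply, Pi.single_apply]
      split_ifs with h
      · subst h
        omega
      · omega
    obtain ⟨a, ha⟩ := ih (v - basisVec i) (by
      have := congrArg (fun w : Fin n → ℕ => ∑ x, w x) hvi
      simp only [Pi.add_apply, Finset.sum_add_distrib, sum_basisVec, Finset.mem_univ, if_true,
        hv] at this
      simpa using this)
    refine ⟨Fin.cons i a, ?_⟩
    rw [← hvi, ← ha, content, Fin.sum_univ_succ, add_comm]
    simp [content]

/-- The character `t ↦ ∏ t_i ^ α_i`. -/
def monomial {ι A : Type*} [Fintype ι] [CommGroup A] (t : ι → A) (α : ι → ℕ) : A := ∏ i, t i ^ α i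

theorem monomial_add {ι A : Type*} [Fintype ι] [CommGroup A] (t : ι → A) (α β : ι → ℕ) :
    monomial t (α + β) = monomial t α * monomial t β := by
  simp [monomial, pow_add, Finset.prod_mul_distrib]

theorem monomial_basisVec {ι A : Type*} [Fintype ι] [DecidableEq ι] [CommGroup A] (t : ι → A)
    (i : ι) : monomial t (basisVec i) = t i := by
  rw [monomial, Finset.prod_eq_single i]
  · rw [basisVec_self, pow_one]
  · intro x _ hx
    rw [basisVec_of_ne hx, pow_zero]
  · simp

theorem monomial_content {n N : ℕ} {A : Type*} [CommGroup A] (t : Fin n → A) (a : Fin N → Fin n) :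
    monomial t (content a) = ∏ k, t (a k) := by
  simp only [← monomial_basisVec t]
  simp only [monomial, content, Finset.sum_apply]
  rw [Finset.prod_comm]
  exact Finset.prod_congr rfl fun i _ => (Finset.prod_pow_eq_pow_sum _ _ _).symm

namespace MConvexSet

variable {n r : ℕ} (J : MConvexSet n r)

theorem lower_le {α : Fin n → ℕ} (hα : α ∈ J.carrier) : J.lower ≤ α := fun _ =>
  Nat.sInf_le ⟨α, hα, rfl⟩

/-- As δ⁻ ≤ α, neither the subtraction in α - δ⁻ nor the one in the effective rank is truncated.
Thus tuples see all of J, up to the shift by δ⁻. -/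
theorem exists_tuple {α : Fin n → ℕ} (hα : α ∈ J.carrier) :
    ∃ a : J.Tuples, content a.1 + J.lower = α := by
  have h : α - J.lower + J.lower = α := tsub_add_cancel_of_le (J.lower_le hα)
  have hs := congrArg (fun w : Fin n → ℕ => ∑ x, w x) h
  simp only [Pi.add_apply, Finset.sum_add_distrib, J.isMConvex.sum_eq α hα] at hs
  obtain ⟨a, ha⟩ := exists_content_eq J.effRank (α - J.lower) (by
    rw [effRank]
    omega)
  have ha' : content a + J.lower = α := by rw [ha, h]
  exact ⟨⟨a, by rwa [reduction, Set.mem_ofPred_eq, ha']⟩, ha'⟩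

instance : Nonempty J.Tuples :=
  let ⟨_, hα⟩ := J.isMConvex.nonempty
  ⟨(J.exists_tuple hα).choose⟩

theorem exists_tuples_of_adjacent {i j : Fin n} (h : Adjacent J.carrier i j) :
    ∃ a b : J.Tuples, content a.1 + basisVec i = content b.1 + basisVec j := by
  obtain ⟨α, hα, β, hβ, e⟩ := h
  obtain ⟨a, rfl⟩ := J.exists_tuple hα
  obtain ⟨b, rfl⟩ := J.exists_tuple hβ
  refine ⟨a, b, add_right_cancel (b := J.lower) ?_⟩
  rwa [add_right_comm, add_right_comm (content b.1)]

/-- A family of group elements is constant on the connected components of `J` if and only if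
the corresponding character is constant on the contents of the tuples of `J`. -/
theorem monomial_content_eq_iff {A : Type*} [CommGroup A] (t : Fin n → A) :
    (∀ a b : J.Tuples, monomial t (content a.1) = monomial t (content b.1)) ↔
      ∀ i j, connSetoid J.carrier i j → t i = t j := by
  constructor
  · refine fun h i j => eq_of_conn fun i j hij => ?_
    obtain ⟨a, b, e⟩ := J.exists_tuples_of_adjacent hij
    have := congrArg (monomial t) e
    rw [monomial_add, monomial_add, h a b, monomial_basisVec, monomial_basisVec] at this
    exact mul_left_cancel this
  · intro h a b
    -- An exchange step multiplies the character by t_i / t_j for adjacent i and j, which is 1. So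
    -- it is constant on J, and the common factor from δ⁻ cancels.
    have := J.isMConvex.eq_of_step_invariant (monomial t) (fun α hα β hβ i j e => by
      have e' := congrArg (monomial t) e
      rw [monomial_add, monomial_add, monomial_basisVec, monomial_basisVec,
        h i j (Relation.EqvGen.rel i j ⟨α, hα, β, hβ, e⟩)] at e'
      exact mul_right_cancel e') a.2 b.2
    rw [monomial_add, monomial_add] at this
    exact mul_right_cancel this

/-- A chosen representative of the connected component of `i`. -/
noncomputable def rep (i : Fin n) : Fin n :=
  (Quotient.mk (connSetoid J.carrier) i).out

theorem conn_rep (i : Fin n) : connSetoid J.carrier (J.rep i) i := Quotient.mk_out i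

theorem rep_eq_iff {i j : Fin n} : J.rep i = J.rep j ↔ connSetoid J.carrier i j := by
  refine ⟨fun h => ?_, fun h => congrArg Quotient.out (Quotient.sound h)⟩
  exact (connSetoid _).trans ((connSetoid _).symm (J.conn_rep i)) (h ▸ J.conn_rep j)

theorem rep_rep (i : Fin n) : J.rep (J.rep i) = J.rep i := J.rep_eq_iff.mpr (J.conn_rep i)

/-- The fixed points of `rep` form a transversal of the components. -/
theorem card_nonrep : Nat.card {i // J.rep i ≠ i} = n - J.numComponents := by
  classical
  have h : Nat.card {i // J.rep i = i} = J.numComponents := by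
    rw [numComponents_eq_card]
    refine Nat.card_eq_of_bijective (fun i => Quotient.mk (connSetoid J.carrier) i.1) ⟨?_, ?_⟩
    · intro i j hij
      exact Subtype.ext (i.2.symm.trans ((J.rep_eq_iff.mpr (Quotient.exact hij)).trans j.2))
    · rintro ⟨i⟩
      exact ⟨⟨J.rep i, J.rep_rep i⟩, Quotient.sound (J.conn_rep i)⟩
  rw [← h, Nat.card_eq_fintype_card, Nat.card_eq_fintype_card, Fintype.card_subtype_compl,
    Fintype.card_fin]

/-- The elements of the ground set that are not the chosen representative of their component. -/
noncomputable def nonrep : Fin (n - J.numComponents) ≃ {i // J.rep i ≠ i} :=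
  (finCongr J.card_nonrep.symm).trans (Finite.equivFin _).symm

/-- The quotient map of the torus by the subtorus of elements that are constant on components. -/
noncomputable def torusHom (A : Type*) [CommGroup A] :
    (Fin n → A) →* (Fin (n - J.numComponents) → A) where
  toFun t k := t (J.nonrep k).1 / t (J.rep (J.nonrep k).1)
  map_one' := by
    funext k
    simp
  map_mul' s t := by
    funext k
    simp [mul_div_mul_comm]

theorem torusHom_apply {A : Type*} [CommGroup A] (t : Fin n → A) (k) :
    J.torusHom A t k = t (J.nonrep k).1 / t (J.rep (J.nonrep k).1) := rfl

theorem torusHom_surjective (A : Type*) [CommGroup A] : Function.Surjective (J.torusHom A) := by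
  classical
  intro s
  -- The preimage has value 1 at each representative, so the denominators of `torusHom` disappear.
  refine ⟨fun i => if h : J.rep i ≠ i then s (J.nonrep.symm ⟨i, h⟩) else 1, funext fun k => ?_⟩
  rw [torusHom_apply, dif_pos (J.nonrep k).2, dif_neg (not_not.mpr (J.rep_rep _)), div_one]
  simp

/-- Being in the kernel says that t_i = t_{rep i} for all i, and `rep` is constant exactly on
components. -/
theorem torusHom_eq_one_iff {A : Type*} [CommGroup A] (t : Fin n → A) :
    J.torusHom A t = 1 ↔ ∀ i j, connSetoid J.carrier i j → t i = t j := by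
  constructor
  · intro h
    have key : ∀ i, t i = t (J.rep i) := by
      intro i
      by_cases hi : J.rep i = i
      · rw [hi]
      · have := congrFun h (J.nonrep.symm ⟨i, hi⟩)
        rw [torusHom_apply, Equiv.apply_symm_apply] at this
        exact div_eq_one.mp this
    intro i j hij
    rw [key i, key j, J.rep_eq_iff.mpr hij]
  · intro h
    funext k
    rw [torusHom_apply, h _ _ (J.conn_rep _), div_self']
    rfl

end MConvexSet

/-! ### Stabilizers, torus orbits and the lineality space -/

section TorusAction

variable {n r : ℕ} {J : MConvexSet n r} {F : Type u} [Tract F]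

theorem WeakRep.weight_eq {N : ℕ} (t : Fin n → Fˣ) (a : Fin N → Fin n) :
    WeakRep.weight t a = monomial t (content a) := (monomial_content t a).symm

theorem WeakRep.apply_ne_zero (ρ : WeakRep J F) (a : J.Tuples) : ρ a.1 ≠ 0 :=
  ((ρ.isUnit_iff a.1).mpr a.2).ne_zero

theorem WeakRep.apply_eq_zero (ρ : WeakRep J F) {a : Fin J.effRank → Fin n}
    (ha : content a ∉ J.reduction) : ρ a = 0 := by
  by_contra h
  exact ha ((ρ.isUnit_iff a).mp (isUnit_iff_ne_zero.mpr h))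

theorem WeakRep.ext_tuples {ρ ρ' : WeakRep J F} (h : ∀ a : J.Tuples, ρ a.1 = ρ' a.1) :
    ρ = ρ' := by
  ext a
  by_cases ha : content a ∈ J.reduction
  · exact h ⟨a, ha⟩
  · exact (ρ.apply_eq_zero ha).trans (ρ'.apply_eq_zero ha).symm

theorem WeakRep.scalar_smul_apply (c : Fˣ) (ρ : WeakRep J F)
    (a : Fin J.effRank → Fin n) : (c • ρ) a = c * ρ a := by
  change ((MonoidHom.inl Fˣ (Fin n → Fˣ) c) • ρ) a = _
  rw [WeakRep.smul_apply]
  simp [WeakRep.weight]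

theorem WeakRep.torus_smul_apply (t : Fin n → Fˣ) (ρ : WeakRep J F)
    (a : Fin J.effRank → Fin n) : (t • ρ) a = (monomial t (content a) : Fˣ) * ρ a := by
  change ((MonoidHom.inr Fˣ (Fin n → Fˣ) t) • ρ) a = _
  rw [WeakRep.smul_apply, WeakRep.weight_eq]
  simp

theorem WeakRep.prod_smul (p : Fˣ × (Fin n → Fˣ)) (ρ : WeakRep J F) :
    p • ρ = p.1 • p.2 • ρ := by
  ext a
  rw [WeakRep.smul_apply, WeakRep.scalar_smul_apply, WeakRep.torus_smul_apply, WeakRep.weight_eq,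
    Units.val_mul, mul_assoc]

theorem Gr.mk_eq_iff {ρ ρ' : WeakRep J F} :
    Gr.mk ρ = Gr.mk ρ' ↔ ∃ c : Fˣ, c • ρ' = ρ :=
  Quotient.eq.trans MulAction.orbitRel_apply

theorem RealizationSpace.mk_eq_iff {ρ ρ' : WeakRep J F} :
    RealizationSpace.mk ρ = RealizationSpace.mk ρ' ↔ ∃ p : Fˣ × (Fin n → Fˣ), p • ρ' = ρ :=
  Quotient.eq.trans MulAction.orbitRel_apply

theorem Gr.smul_mk (t : Fin n → Fˣ) (ρ : WeakRep J F) :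
    t • Gr.mk ρ = Gr.mk (t • ρ) := rfl

/-- The stabilizer of a class in the torus is the kernel of `torusHom`. -/
theorem Gr.smul_eq_iff (x : Gr J F) (t : Fin n → Fˣ) :
    t • x = x ↔ J.torusHom Fˣ t = 1 := by
  rw [J.torusHom_eq_one_iff, ← J.monomial_content_eq_iff]
  obtain ⟨ρ, rfl⟩ : ∃ ρ, Gr.mk ρ = x := Quotient.exists_rep x
  rw [Gr.smul_mk, Gr.mk_eq_iff]
  -- The values of ρ at the tuples of J are nonzero and cancel, so the condition no longer involves
  -- ρ.
  have key : ∀ c : Fˣ, c • ρ = t • ρ ↔ ∀ a : J.Tuples, monomial t (content a.1) = c := by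
    intro c
    constructor
    · intro h a
      have := congrArg (fun ρ : WeakRep J F => ρ a.1) h
      simp only [WeakRep.scalar_smul_apply, WeakRep.torus_smul_apply] at this
      exact Units.ext (mul_right_cancel₀ (ρ.apply_ne_zero a) this.symm)
    · intro h
      refine WeakRep.ext_tuples fun a => ?_
      rw [WeakRep.scalar_smul_apply, WeakRep.torus_smul_apply, h a]
  simp only [key]
  constructor
  · rintro ⟨c, hc⟩ a b
    rw [hc a, hc b]
  · intro h
    -- The scalar is the value of the character at an arbitrary tuple, which exists because J is
    -- nonempty.
    exact ⟨_, fun a => h a (Classical.arbitrary _)⟩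

theorem Gr.smul_eq_smul_iff (x : Gr J F) (s t : Fin n → Fˣ) :
    s • x = t • x ↔ J.torusHom Fˣ s = J.torusHom Fˣ t := by
  rw [← inv_smul_eq_iff, smul_smul, Gr.smul_eq_iff, map_mul, map_inv, inv_mul_eq_one, eq_comm]

/-- The orbit is the torus modulo the stabilizer, which is the kernel of the surjection `torusHom`.
Thus any t that carries x to the given point may be used to define the bijection. -/
theorem Gr.exists_orbitEquiv (x : Gr J F) :
    ∃ e : MulAction.orbit (Fin n → Fˣ) x ≃ (Fin (n - J.numComponents) → Fˣ),
      ∀ t : Fin n → Fˣ, e ⟨t • x, MulAction.mem_orbit x t⟩ = J.torusHom Fˣ t := by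
  let f : MulAction.orbit (Fin n → Fˣ) x → (Fin (n - J.numComponents) → Fˣ) :=
    fun y => J.torusHom Fˣ y.2.choose
  have hf : ∀ t : Fin n → Fˣ, f ⟨t • x, MulAction.mem_orbit x t⟩ = J.torusHom Fˣ t := fun t =>
    (Gr.smul_eq_smul_iff x _ t).mp (MulAction.mem_orbit x t).choose_spec
  refine ⟨Equiv.ofBijective f ⟨?_, fun s => ?_⟩, hf⟩
  · rintro ⟨_, s, rfl⟩ ⟨_, t, rfl⟩ h
    exact Subtype.ext ((Gr.smul_eq_smul_iff x s t).mpr ((hf s).symm.trans (h.trans (hf t))))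
  · obtain ⟨t, rfl⟩ := J.torusHom_surjective Fˣ s
    exact ⟨_, hf t⟩

/-- The trivial representation has value 1 at the tuples of J, so representatives of points of its
orbit have values c t^{Σa}, and these multiply pointwise. -/
theorem lineality_mul {h : IsIdempotent F} (ρ₁ ρ₂ ρ₃ : WeakRep J F)
    {t₁ t₂ : Fin n → Fˣ} (h₁ : t₁ • Gr.mk (WeakRep.trivial J h) = Gr.mk ρ₁)
    (h₂ : t₂ • Gr.mk (WeakRep.trivial J h) = Gr.mk ρ₂) (h₃ : ∀ a, ρ₃ a = ρ₁ a * ρ₂ a) :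
    Gr.mk ρ₃ = (t₁ * t₂) • Gr.mk (WeakRep.trivial J h) := by
  rw [Gr.smul_mk, eq_comm, Gr.mk_eq_iff] at h₁ h₂
  rw [Gr.smul_mk, Gr.mk_eq_iff]
  obtain ⟨c₁, rfl⟩ := h₁
  obtain ⟨c₂, rfl⟩ := h₂
  refine ⟨c₁ * c₂, WeakRep.ext_tuples fun a => ?_⟩
  have h1 : WeakRep.trivial J h a.1 = 1 := if_pos a.2
  rw [h₃]
  simp only [WeakRep.scalar_smul_apply, WeakRep.torus_smul_apply, h1, mul_one]
  rw [← WeakRep.weight_eq, ← WeakRep.weight_eq, ← WeakRep.weight_eq]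
  simp only [WeakRep.weight, Pi.mul_apply, Finset.prod_mul_distrib, Units.val_mul]
  ac_rfl

theorem exists_linealityEquiv (h : IsIdempotent F) :
    ∃ e : lineality J h ≃ (Fin (n - J.numComponents) → Fˣ),
      ∀ (ρ₁ ρ₂ ρ₃ : WeakRep J F) (h₁ : Gr.mk ρ₁ ∈ lineality J h)
        (h₂ : Gr.mk ρ₂ ∈ lineality J h) (h₃ : Gr.mk ρ₃ ∈ lineality J h),
        (∀ a, ρ₃ a = ρ₁ a * ρ₂ a) → e ⟨_, h₃⟩ = e ⟨_, h₁⟩ * e ⟨_, h₂⟩ := by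
  obtain ⟨e, he⟩ := Gr.exists_orbitEquiv (Gr.mk (WeakRep.trivial J h))
  have he' : ∀ (y : Gr J F) (hy : y ∈ lineality J h) (t : Fin n → Fˣ),
      t • Gr.mk (WeakRep.trivial J h) = y → e ⟨y, hy⟩ = J.torusHom Fˣ t := by
    rintro _ _ t rfl
    exact he t
  refine ⟨e, fun ρ₁ ρ₂ ρ₃ h₁ h₂ h₃ hmul => ?_⟩
  obtain ⟨t₁, ht₁⟩ := id h₁
  obtain ⟨t₂, ht₂⟩ := id h₂
  exact (he' _ h₃ _ (lineality_mul ρ₁ ρ₂ ρ₃ ht₁ ht₂ hmul).symm).trans ((map_mul _ _ _).trans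
    (congrArg₂ _ (he' _ h₁ _ ht₁).symm (he' _ h₂ _ ht₂).symm))

end TorusAction

/-! ### Tract morphisms described on unit groups -/

theorem map_congr_hom {G : Type u} {H : Type v} [CommGroup G] [CommGroup H] {f g : G →* H}
    (h : ∀ x, f x = g x) (s : MonoidAlgebra ℕ G) :
    MonoidAlgebra.mapDomainRingHom ℕ f s = MonoidAlgebra.mapDomainRingHom ℕ g s := by
  rw [MonoidHom.ext h]

theorem map_eq_self {G : Type u} [CommGroup G] {f : G →* G} (h : ∀ x, f x = x)
    (s : MonoidAlgebra ℕ G) : MonoidAlgebra.mapDomainRingHom ℕ f s = s := by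
  rw [show f = MonoidHom.id G from MonoidHom.ext h]
  exact RingHom.congr_fun MonoidAlgebra.mapDomainRingHom_id s

section UnitHoms

variable {F₁ : Type u} {F₂ : Type v} [Tract F₁] [Tract F₂]

open Classical in
/-- The tract morphism given by a homomorphism of unit groups that preserves the null sets. -/
noncomputable def TractHom.ofUnits (f : F₁ˣ →* F₂ˣ)
    (hf : Tract.null (F := F₁) ≤
      (Tract.null (F := F₂)).comap (MonoidAlgebra.mapDomainRingHom ℕ f)) :
    TractHom F₁ F₂ where
  toFun a := if h : a = 0 then 0 else (f (Units.mk0 a h) : F₂ˣ)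
  map_zero' := by simp
  map_one' := by simp
  map_mul' a b := by
    by_cases ha : a = 0
    · simp [ha]
    by_cases hb : b = 0
    · simp [hb]
    simp [ha, hb, Units.mk0_mul]
  map_null s hs := by
    refine Eq.subst (motive := (· ∈ Tract.null)) (map_congr_hom (fun u => ?_) s) (hf hs)
    refine Units.ext (Eq.symm ((dif_neg u.ne_zero).trans ?_))
    rw [Units.mk0_val]

theorem TractHom.ofUnits_coe (f : F₁ˣ →* F₂ˣ)
    (hf : Tract.null (F := F₁) ≤ (Tract.null (F := F₂)).comap (MonoidAlgebra.mapDomainRingHom ℕ f))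
    (u : F₁ˣ) : TractHom.ofUnits f hf (u : F₁) = f u := by
  refine (dif_neg u.ne_zero).trans ?_
  rw [Units.mk0_val]

theorem TractHom.coe_units (f : TractHom F₁ F₂) (u : F₁ˣ) : ((f.units u : F₂ˣ) : F₂) = f u := rfl

theorem TractHom.ofUnits_units (f : F₁ˣ →* F₂ˣ)
    (hf : Tract.null (F := F₁) ≤
      (Tract.null (F := F₂)).comap (MonoidAlgebra.mapDomainRingHom ℕ f)) :
    (TractHom.ofUnits f hf).units = f :=
  MonoidHom.ext fun u => Units.ext (TractHom.ofUnits_coe f hf u)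

theorem TractHom.apply_zero (f : TractHom F₁ F₂) : f 0 = 0 := map_zero f.toMonoidWithZeroHom

theorem TractHom.ext_units {f g : TractHom F₁ F₂} (h : f.units = g.units) : f = g := by
  have : f.toMonoidWithZeroHom = g.toMonoidWithZeroHom := by
    ext a
    by_cases ha : a = 0
    · rw [ha, map_zero, map_zero]
    · exact congrArg Units.val (DFunLike.congr_fun h (Units.mk0 a ha))
  cases f
  cases g
  cases this
  rfl

theorem TractHom.null_le (f : TractHom F₁ F₂) :
    Tract.null (F := F₁) ≤
      (Tract.null (F := F₂)).comap (MonoidAlgebra.mapDomainRingHom ℕ f.units) := f.map_null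

theorem TractHom.units_negOne (f : TractHom F₁ F₂) : f.units Tract.negOne = Tract.negOne :=
  Units.ext f.map_negOne

/-- The composition of tract morphisms. -/
noncomputable def TractHom.comp {F₃ : Type w} [Tract F₃] (g : TractHom F₂ F₃)
    (f : TractHom F₁ F₂) : TractHom F₁ F₃ where
  toMonoidWithZeroHom := g.toMonoidWithZeroHom.comp f.toMonoidWithZeroHom
  map_null s hs := by
    have := g.map_null _ (f.map_null s hs)
    rwa [map_map] at this

/-- An isomorphism of unit groups that identifies the null sets is an isomorphism of tracts. -/
noncomputable def TractIso.ofUnits (e : F₁ˣ ≃* F₂ˣ)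
    (h : ∀ s, s ∈ Tract.null (F := F₁) ↔
      MonoidAlgebra.mapDomainRingHom ℕ e.toMonoidHom s ∈ Tract.null (F := F₂)) :
    TractIso F₁ F₂ where
  hom := TractHom.ofUnits e.toMonoidHom fun s hs => Ideal.mem_comap.mpr ((h s).mp hs)
  inv := TractHom.ofUnits e.symm.toMonoidHom fun s hs => by
    rw [Ideal.mem_comap, h, map_map]
    rwa [map_eq_self fun u => e.apply_symm_apply u]
  inv_hom a := by
    by_cases ha : a = 0
    · rw [ha, TractHom.apply_zero, TractHom.apply_zero]
    · lift a to F₁ˣ using IsUnit.mk0 a ha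
      rw [TractHom.ofUnits_coe, TractHom.ofUnits_coe]
      exact congrArg Units.val (e.symm_apply_apply a)
  hom_inv a := by
    by_cases ha : a = 0
    · rw [ha, TractHom.apply_zero, TractHom.apply_zero]
    · lift a to F₂ˣ using IsUnit.mk0 a ha
      rw [TractHom.ofUnits_coe, TractHom.ofUnits_coe]
      exact congrArg Units.val (e.apply_symm_apply a)

theorem TractHom.map_formal (f : TractHom F₁ F₂) (a : F₁) :
    MonoidAlgebra.mapDomainRingHom ℕ f.units (formal a) = formal (f a) :=
  PolyTract.map_formal f.toMonoidWithZeroHom a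

theorem TractHom.apply_mul (f : TractHom F₁ F₂) (a b : F₁) : f (a * b) = f a * f b :=
  map_mul f.toMonoidWithZeroHom a b

theorem TractHom.map_plucker₃ (f : TractHom F₁ F₂) {n m N : ℕ} (h : m + 2 = N)
    (ρ : (Fin N → Fin n) → F₁) (a : Fin m → Fin n) (i j k l : Fin n) :
    MonoidAlgebra.mapDomainRingHom ℕ f.units (plucker₃ h ρ a i j k l) =
      plucker₃ h (fun b => f (ρ b)) a i j k l := by
  simp only [plucker₃, map_add, TractHom.map_formal, TractHom.apply_mul, TractHom.map_negOne]

end UnitHoms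

/-! ### Morphisms out of the regular partial field -/

namespace RegularPartialField

/-- The unit group of the regular partial field. -/
def unitsEquiv : RegularPartialFieldˣ ≃* ℤˣ := WithZero.unitsWithZeroEquiv

theorem eq_one_or_eq_negOne (u : RegularPartialFieldˣ) : u = 1 ∨ u = Tract.negOne := by
  rcases Int.units_eq_one_or (unitsEquiv u) with h | h
  · exact Or.inl (unitsEquiv.injective (h.trans (map_one unitsEquiv).symm))
  · exact Or.inr (unitsEquiv.injective h)

theorem hom_ext {M : Type*} [Monoid M] {f g : RegularPartialFieldˣ →* M}
    (h : f Tract.negOne = g Tract.negOne) : f = g := by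
  ext u
  rcases eq_one_or_eq_negOne u with rfl | rfl
  · rw [map_one, map_one]
  · exact h

theorem mem_null_iff (s : MonoidAlgebra ℕ RegularPartialFieldˣ) : s ∈ Tract.null ↔
    MonoidAlgebra.mapDomainRingHom ℕ unitsEquiv.toMonoidHom s ∈
      Ideal.span {(MonoidAlgebra.single (1 : ℤˣ) 1 + MonoidAlgebra.single (-1) 1 :
        MonoidAlgebra ℕ ℤˣ)} := Iff.rfl

/-- The null set is generated by the single element 1 + (-1), so only its image has to be checked.
-/
theorem null_le {A : Type u} [CommGroup A] {N : Ideal (MonoidAlgebra ℕ A)}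
    (f : RegularPartialFieldˣ →* A)
    (hf : MonoidAlgebra.single 1 1 + MonoidAlgebra.single (f Tract.negOne) 1 ∈ N) :
    Tract.null (F := RegularPartialField) ≤ N.comap (MonoidAlgebra.mapDomainRingHom ℕ f) := by
  intro s hs
  let g : ℤˣ →* A := f.comp unitsEquiv.symm.toMonoidHom
  have := (Ideal.span_singleton_le_iff_mem (N.comap (MonoidAlgebra.mapDomainRingHom ℕ g))).mpr
    (by
      rw [Ideal.mem_comap, map_add, map_single, map_single, map_one]
      exact hf) ((mem_null_iff s).mp hs)
  rw [Ideal.mem_comap, map_map] at this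
  rwa [map_congr_hom (f := g.comp unitsEquiv.toMonoidHom) (g := f)
    fun a => congrArg f (unitsEquiv.symm_apply_apply a)] at this

variable (F : Type u) [Tract F]

/-- The homomorphism from the unit group of the regular partial field to that of a tract. -/
noncomputable def signHom : RegularPartialFieldˣ →* Fˣ :=
  MonoidHom.comp
    { toFun := fun s : ℤˣ => if s = 1 then 1 else Tract.negOne
      map_one' := if_pos rfl
      map_mul' := fun s t => by
        rcases Int.units_eq_one_or s with rfl | rfl <;>
          rcases Int.units_eq_one_or t with rfl | rfl <;> simp [Tract.negOne_mul_self] }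
    unitsEquiv.toMonoidHom

theorem signHom_negOne : signHom F Tract.negOne = Tract.negOne := rfl

end RegularPartialField

/-! ### Morphisms out of free algebras -/

namespace FreeAlgebra

variable {k : Type u} [Tract k] {I : Type v}

theorem mem_null_iff (s : MonoidAlgebra ℕ (FreeAlgebra k I)ˣ) : s ∈ Tract.null ↔
    MonoidAlgebra.mapDomainRingHom ℕ (unitsEquiv (k := k) (I := I)).toMonoidHom s ∈
      (Tract.null (F := k)).map (MonoidAlgebra.mapDomainRingHom ℕ
        (MonoidHom.inl kˣ (Multiplicative (I →₀ ℤ)))) := Iff.rfl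

theorem const_unit (a : kˣ) : const (a : k) = ((unitsEquiv.symm (a, 1) : (FreeAlgebra k I)ˣ) :
    FreeAlgebra k I) := by
  refine (dif_neg a.ne_zero).trans ?_
  rw [Units.mk0_val]

theorem units_const (a : kˣ) : (const (I := I)).units a = unitsEquiv.symm (a, 1) :=
  Units.ext (const_unit a)

/-- The homomorphism from the group of monomials with `x_i ↦ v i`. -/
noncomputable def monomialHom {A : Type*} [CommGroup A] (v : I → A) :
    Multiplicative (I →₀ ℤ) →* A :=
  AddMonoidHom.toMultiplicativeLeft
    (Finsupp.liftAddHom fun i => zmultiplesHom (Additive A) (Additive.ofMul (v i)))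

theorem monomialHom_single {A : Type*} [CommGroup A] (v : I → A) (i : I) :
    monomialHom v (Multiplicative.ofAdd (Finsupp.single i 1)) = v i := by
  simp [monomialHom]

/-- The homomorphism on units with given values on the coefficients and the variables. -/
noncomputable def unitsLift {A : Type*} [CommGroup A] (f : kˣ →* A) (v : I → A) :
    (FreeAlgebra k I)ˣ →* A :=
  (f.coprod (monomialHom v)).comp unitsEquiv.toMonoidHom

theorem unitsLift_X {A : Type*} [CommGroup A] (f : kˣ →* A) (v : I → A) (i : I) :
    unitsLift f v (X i) = v i := by
  simp [unitsLift, X, monomialHom_single]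

theorem unitsLift_const {A : Type*} [CommGroup A] (f : kˣ →* A) (v : I → A) (a : kˣ) :
    unitsLift f v ((const (I := I)).units a) = f a := by
  simp [unitsLift, units_const]

/-- The unit group is the product of the unit group of k and the free abelian group on the
variables. -/
theorem hom_ext {A : Type*} [CommGroup A] {f g : (FreeAlgebra k I)ˣ →* A}
    (hc : ∀ a : kˣ, f ((const (I := I)).units a) = g ((const (I := I)).units a))
    (hX : ∀ i, f (X i) = g (X i)) : f = g := by
  have hI : (f.comp (unitsEquiv (k := k) (I := I)).symm.toMonoidHom).comp (MonoidHom.inr _ _) =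
      (g.comp (unitsEquiv (k := k) (I := I)).symm.toMonoidHom).comp (MonoidHom.inr _ _) := by
    refine AddMonoidHom.toMultiplicativeLeft.symm.injective (Finsupp.addHom_ext' fun i => ?_)
    refine AddMonoidHom.ext_int ?_
    exact congrArg Additive.ofMul (hX i)
  refine MonoidHom.ext fun u => ?_
  obtain ⟨⟨a, e⟩, rfl⟩ := (unitsEquiv (k := k) (I := I)).symm.surjective u
  have hsplit : (a, e) = (a, 1) * ((1, e) : kˣ × Multiplicative (I →₀ ℤ)) := by simp
  rw [hsplit, map_mul, map_mul, map_mul, ← units_const, hc a]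
  exact congrArg _ (DFunLike.congr_fun hI e)

/-- A homomorphism of units maps the null set into an ideal if its restriction to the coefficients
does. -/
theorem null_le_of_const {A : Type w} [CommGroup A] {N : Ideal (MonoidAlgebra ℕ A)}
    (f : (FreeAlgebra k I)ˣ →* A)
    (hf : Tract.null (F := k) ≤
      N.comap (MonoidAlgebra.mapDomainRingHom ℕ (f.comp (const (I := I)).units))) :
    Tract.null (F := FreeAlgebra k I) ≤ N.comap (MonoidAlgebra.mapDomainRingHom ℕ f) := by
  intro s hs
  let g : kˣ × Multiplicative (I →₀ ℤ) →* A :=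
    f.comp (unitsEquiv (k := k) (I := I)).symm.toMonoidHom
  have key : (Tract.null (F := k)).map (MonoidAlgebra.mapDomainRingHom ℕ
      (MonoidHom.inl kˣ (Multiplicative (I →₀ ℤ)))) ≤
        N.comap (MonoidAlgebra.mapDomainRingHom ℕ g) := by
    rw [Ideal.map_le_iff_le_comap]
    intro t ht
    have := hf ht
    rw [Ideal.mem_comap] at this
    rw [Ideal.mem_comap, Ideal.mem_comap, map_map]
    rwa [map_congr_hom (g := g.comp (MonoidHom.inl kˣ (Multiplicative (I →₀ ℤ))))
      fun a => congrArg f (units_const a)] at this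
  have := key ((mem_null_iff s).mp hs)
  rw [Ideal.mem_comap, map_map] at this
  rwa [map_congr_hom (f := g.comp (unitsEquiv (k := k) (I := I)).toMonoidHom) (g := f)
    fun a => congrArg f (unitsEquiv.symm_apply_apply a)] at this

end FreeAlgebra

/-! ### Morphisms out of quotients -/

namespace TractQuotient

variable {F : Type u} [Tract F] {S : Set (MonoidAlgebra ℕ Fˣ)}
  {hS : ∀ a, MonoidAlgebra.single a 1 ∉ S} {F₂ : Type v} [Tract F₂]

/-- The quotient map on units. -/
noncomputable def mkUnits : Fˣ →* (TractQuotient F S hS)ˣ :=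
  (unitsEquiv (hS := hS)).symm.toMonoidHom.comp (QuotientGroup.mk' (relSubgroup S))

theorem mkUnits_surjective : Function.Surjective (mkUnits (hS := hS)) :=
  (unitsEquiv (hS := hS)).symm.surjective.comp (QuotientGroup.mk'_surjective _)

theorem mk_unit (u : Fˣ) : mk (hS := hS) (u : F) =
    (mkUnits (hS := hS) u : (TractQuotient F S hS)ˣ) := by
  refine (dif_neg u.ne_zero).trans ?_
  rw [Units.mk0_val]
  rfl

theorem mk_zero : mk (hS := hS) 0 = 0 := dif_pos rfl

theorem mkUnits_negOne : mkUnits (hS := hS) Tract.negOne = Tract.negOne := rfl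

theorem mem_null_iff (s : MonoidAlgebra ℕ (TractQuotient F S hS)ˣ) : s ∈ Tract.null ↔
    MonoidAlgebra.mapDomainRingHom ℕ (unitsEquiv (hS := hS)).toMonoidHom s ∈ nullIdeal S := Iff.rfl

theorem unitsLift_mkUnits {A : Type*} [CommGroup A] (d : Fˣ →* A) (hd : relSubgroup S ≤ d.ker)
    (u : Fˣ) : unitsLift (hS := hS) d hd (mkUnits u) = d u := by
  simp [unitsLift, mkUnits]

/-- This moves the definition of the null set from the quotient group to the actual unit group, so
that inclusions of null sets can be tested on the images of the two kinds of generators. -/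
theorem null_eq_span : Tract.null (F := TractQuotient F S hS) =
    Ideal.span (MonoidAlgebra.mapDomainRingHom ℕ (mkUnits (hS := hS)) ''
      ((Tract.null (F := F) : Set (MonoidAlgebra ℕ Fˣ)) ∪ S)) := by
  refine le_antisymm (fun s hs => ?_) (Ideal.span_le.mpr ?_)
  · have key : nullIdeal S ≤ (Ideal.span (MonoidAlgebra.mapDomainRingHom ℕ (mkUnits (hS := hS)) ''
        ((Tract.null (F := F) : Set (MonoidAlgebra ℕ Fˣ)) ∪ S))).comap
          (MonoidAlgebra.mapDomainRingHom ℕ (unitsEquiv (hS := hS)).symm.toMonoidHom) := by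
      refine Ideal.span_le.mpr ?_
      rintro _ ⟨t, ht, rfl⟩
      rw [SetLike.mem_coe, Ideal.mem_comap, map_map]
      exact Ideal.subset_span ⟨t, ht, rfl⟩
    have := key ((mem_null_iff s).mp hs)
    rw [Ideal.mem_comap, map_map] at this
    rwa [map_eq_self fun u => unitsEquiv.symm_apply_apply u] at this
  · rintro _ ⟨t, ht, rfl⟩
    rw [SetLike.mem_coe, mem_null_iff, map_map]
    exact Ideal.subset_span ⟨t, ht, map_congr_hom (fun u =>
      ((unitsEquiv (hS := hS)).apply_symm_apply _).symm) t⟩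

variable (hS) in
/-- The quotient map as a morphism. -/
noncomputable def mkHom : TractHom F (TractQuotient F S hS) :=
  TractHom.ofUnits mkUnits fun s hs => by
    rw [null_eq_span]
    exact Ideal.subset_span ⟨s, Or.inl hs, rfl⟩

theorem mkHom_units : (mkHom hS).units = mkUnits := TractHom.ofUnits_units _ _

theorem mkHom_apply (a : F) : mkHom hS a = mk a := by
  by_cases ha : a = 0
  · rw [ha, TractHom.apply_zero, mk_zero]
  · lift a to Fˣ using IsUnit.mk0 a ha
    rw [mkHom, TractHom.ofUnits_coe, mk_unit]

/-- Additive inverses in a tract are unique: if d(a) + (-1) d(b) is null, then d(a) = d(b). So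
preserving null sums already forces the multiplicative relations. -/
theorem relSubgroup_le_ker_of_null (d : Fˣ →* F₂ˣ) (hneg : d Tract.negOne = Tract.negOne)
    (hS : ∀ s ∈ S, MonoidAlgebra.mapDomainRingHom ℕ d s ∈ Tract.null (F := F₂)) :
    relSubgroup S ≤ d.ker := by
  rw [relSubgroup, Subgroup.closure_le]
  rintro _ ⟨a, b, hab, rfl⟩
  have := hS _ hab
  rw [map_add, map_single, map_single, Tract.single_mem_iff, map_mul, hneg] at this
  rw [SetLike.mem_coe, MonoidHom.mem_ker, map_div, mul_left_cancel this, div_self']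

/-- The morphism out of a quotient that is induced by a homomorphism on units. -/
noncomputable def lift (d : Fˣ →* F₂ˣ) (hneg : d Tract.negOne = Tract.negOne)
    (hd : Tract.null (F := F) ≤ (Tract.null (F := F₂)).comap (MonoidAlgebra.mapDomainRingHom ℕ d))
    (hdS : ∀ s ∈ S, MonoidAlgebra.mapDomainRingHom ℕ d s ∈ Tract.null (F := F₂)) :
    TractHom (TractQuotient F S hS) F₂ :=
  TractHom.ofUnits (unitsLift d (relSubgroup_le_ker_of_null d hneg hdS)) (by
    rw [null_eq_span, Ideal.span_le]
    have e : (unitsLift (hS := hS) d (relSubgroup_le_ker_of_null d hneg hdS)).comp mkUnits = d :=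
      MonoidHom.ext (unitsLift_mkUnits (hS := hS) d (relSubgroup_le_ker_of_null d hneg hdS))
    rintro _ ⟨s, hs, rfl⟩
    rw [SetLike.mem_coe, Ideal.mem_comap, map_map, e]
    exact hs.elim (fun hs => hd hs) (hdS s))

end TractQuotient

/-! ### The morphism defined by a weak representation -/

namespace MConvexSet

variable {n r : ℕ} (J : MConvexSet n r)

/-- The variable `x_a` as a unit of the extended universal pasture. -/
noncomputable def unitVar (a : J.Tuples) : J.ExtPastureˣ :=
  TractQuotient.mkUnits (FreeAlgebra.X a)

theorem var_tuple (a : J.Tuples) : J.var a.1 =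
    ((FreeAlgebra.X a : (FreeAlgebra RegularPartialField J.Tuples)ˣ) : FreeAlgebra _ _) :=
  dif_pos a.2

theorem univRep_tuple (a : J.Tuples) : J.univRep a.1 = J.unitVar a := by
  rw [univRep, var_tuple, TractQuotient.mk_unit]
  rfl

theorem univRep_eq_zero {a : Fin J.effRank → Fin n} (ha : content a ∉ J.reduction) :
    J.univRep a = 0 := by
  rw [univRep, (J.var_eq_zero_iff a).mpr ha, TractQuotient.mk_zero]

/-- The unit group of the extended universal pasture is generated by `-1` and the `x_a`. -/
theorem extPasture_hom_ext {A : Type*} [CommGroup A] {f g : J.ExtPastureˣ →* A}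
    (hneg : f Tract.negOne = g Tract.negOne) (hX : ∀ a, f (J.unitVar a) = g (J.unitVar a)) :
    f = g := by
  have : f.comp TractQuotient.mkUnits = g.comp TractQuotient.mkUnits := by
    refine FreeAlgebra.hom_ext (fun a => ?_) hX
    refine DFunLike.congr_fun (f := (f.comp TractQuotient.mkUnits).comp FreeAlgebra.const.units)
      (g := (g.comp TractQuotient.mkUnits).comp FreeAlgebra.const.units)
      (RegularPartialField.hom_ext ?_) a
    simpa only [MonoidHom.comp_apply, TractHom.units_negOne, TractQuotient.mkUnits_negOne]
      using hneg
  ext u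
  obtain ⟨u, rfl⟩ := TractQuotient.mkUnits_surjective u
  exact DFunLike.congr_fun this u

end MConvexSet

section Universal

variable {n r : ℕ} {J : MConvexSet n r} {F : Type u} [Tract F]

/-- The value of a weak representation at a tuple, as a unit. -/
noncomputable def WeakRep.unit (ρ : WeakRep J F) (a : J.Tuples) : Fˣ :=
  Units.mk0 _ (ρ.apply_ne_zero a)

/-- The homomorphism on the units of the free algebra defined by a weak representation. -/
noncomputable def WeakRep.unitsHom (ρ : WeakRep J F) :
    (FreeAlgebra RegularPartialField J.Tuples)ˣ →* Fˣ :=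
  FreeAlgebra.unitsLift (RegularPartialField.signHom F) ρ.unit

theorem WeakRep.unitsHom_null (ρ : WeakRep J F) :
    Tract.null (F := FreeAlgebra RegularPartialField J.Tuples) ≤
      (Tract.null (F := F)).comap (MonoidAlgebra.mapDomainRingHom ℕ ρ.unitsHom) := by
  refine FreeAlgebra.null_le_of_const _ ?_
  have : ρ.unitsHom.comp FreeAlgebra.const.units = RegularPartialField.signHom F :=
    MonoidHom.ext (FreeAlgebra.unitsLift_const _ _)
  rw [this]
  refine RegularPartialField.null_le _ ?_
  rw [RegularPartialField.signHom_negOne, Tract.single_mem_iff, mul_one]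

/-- The morphism from the free algebra defined by a weak representation. -/
noncomputable def WeakRep.freeHom (ρ : WeakRep J F) :
    TractHom (FreeAlgebra RegularPartialField J.Tuples) F :=
  TractHom.ofUnits ρ.unitsHom ρ.unitsHom_null

theorem WeakRep.freeHom_var (ρ : WeakRep J F) (a : Fin J.effRank → Fin n) :
    ρ.freeHom (J.var a) = ρ a := by
  by_cases ha : content a ∈ J.reduction
  · rw [J.var_tuple ⟨a, ha⟩, WeakRep.freeHom, TractHom.ofUnits_coe, WeakRep.unitsHom,
      FreeAlgebra.unitsLift_X]
    rfl
  · rw [(J.var_eq_zero_iff a).mpr ha, TractHom.apply_zero, ρ.apply_eq_zero ha]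

/-- The morphism turns the Plücker relations into the axiom `plucker` for ρ, and the alternating
relations into `comp_perm` together with the existence of additive inverses. -/
theorem WeakRep.freeHom_relations (ρ : WeakRep J F) : ∀ s ∈ J.relations,
    MonoidAlgebra.mapDomainRingHom ℕ ρ.freeHom.units s ∈ Tract.null (F := F) := by
  rintro _ (⟨m, h, a, i, j, k, l, hw, rfl⟩ | ⟨a, σ, rfl⟩)
  · rw [TractHom.map_plucker₃]
    simp only [ρ.freeHom_var]
    exact ρ.plucker m h a i j k l hw
  · rw [map_add, TractHom.map_formal, TractHom.map_formal, Tract.formal_add_formal_mem_null,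
      TractHom.apply_mul, Units.val_mul, TractHom.apply_mul, TractHom.map_negOne,
      TractHom.map_signIn, ρ.freeHom_var, ρ.freeHom_var, ρ.comp_perm, mul_assoc]

/-- The morphism from the extended universal pasture defined by a weak representation. -/
noncomputable def WeakRep.toHom (ρ : WeakRep J F) : TractHom J.ExtPasture F :=
  TractQuotient.lift ρ.freeHom.units ρ.freeHom.units_negOne ρ.freeHom.null_le ρ.freeHom_relations

theorem WeakRep.toHom_units_unitVar (ρ : WeakRep J F) (a : J.Tuples) :
    ρ.toHom.units (J.unitVar a) = ρ.unit a := by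
  rw [WeakRep.toHom, TractQuotient.lift, TractHom.ofUnits_units, MConvexSet.unitVar,
    TractQuotient.unitsLift_mkUnits]
  refine Units.ext ((TractHom.coe_units _ _).trans ?_)
  rw [← J.var_tuple, ρ.freeHom_var]
  rfl

theorem WeakRep.toHom_univRep (ρ : WeakRep J F) (a : Fin J.effRank → Fin n) :
    ρ.toHom (J.univRep a) = ρ a := by
  by_cases ha : content a ∈ J.reduction
  · rw [J.univRep_tuple ⟨a, ha⟩, ← TractHom.coe_units, ρ.toHom_units_unitVar]
    rfl
  · rw [J.univRep_eq_zero ha, TractHom.apply_zero, ρ.apply_eq_zero ha]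

theorem WeakRep.eq_toHom (ρ : WeakRep J F) {f : TractHom J.ExtPasture F}
    (hf : ∀ a, f (J.univRep a) = ρ a) : f = ρ.toHom := by
  refine TractHom.ext_units (J.extPasture_hom_ext ?_ fun a => ?_)
  · rw [TractHom.units_negOne, TractHom.units_negOne]
  · rw [ρ.toHom_units_unitVar]
    refine Units.ext ((TractHom.coe_units _ _).trans ?_)
    rw [← J.univRep_tuple, hf]
    rfl

theorem WeakRep.toHom_map {F₂ : Type v} [Tract F₂] (f : TractHom F F₂)
    (ρ : WeakRep J F) : (ρ.map f).toHom = f.comp ρ.toHom :=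
  ((ρ.map f).eq_toHom fun a => congrArg f (ρ.toHom_univRep a)).symm

end Universal

/-! ### Extension and contraction of ideals between group semirings -/

section GroupSemiring

variable {G : Type u} {H : Type v} [CommGroup G] [CommGroup H]

open Classical in
/-- The projection of `ℕ[G]` onto `ℕ[H]` for a homomorphism `ι : H → G`, which is the identity on
`ℕ[H]` if `ι` is injective, and which maps the elements outside the range of `ι` to zero. -/
noncomputable def rangeProj (ι : H →* G) : MonoidAlgebra ℕ G →+ MonoidAlgebra ℕ H :=
  MonoidAlgebra.liftNC (Nat.castAddMonoidHom _) fun x =>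
    if h : ∃ y, ι y = x then MonoidAlgebra.single h.choose 1 else 0

theorem rangeProj_single {ι : H →* G} (hι : Function.Injective ι) (y : H) (k : ℕ) :
    rangeProj ι (MonoidAlgebra.single (ι y) k) = MonoidAlgebra.single y k := by
  have h : ∃ z, ι z = ι y := ⟨y, rfl⟩
  rw [rangeProj, MonoidAlgebra.liftNC_single, dif_pos h, hι h.choose_spec]
  rw [Nat.coe_castAddMonoidHom, ← nsmul_eq_mul, MonoidAlgebra.smul_single, smul_eq_mul, mul_one]

theorem rangeProj_single_of_notMem {ι : H →* G} {x : G} (hx : ¬ ∃ y, ι y = x) (k : ℕ) :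
    rangeProj ι (MonoidAlgebra.single x k) = 0 := by
  rw [rangeProj, MonoidAlgebra.liftNC_single, dif_neg hx, mul_zero]

/-- Multiplication by an element of the range of ι preserves both the range and its complement, so
the projection is linear over ℕ[H]. -/
theorem rangeProj_mul_map {ι : H →* G} (hι : Function.Injective ι) (g : MonoidAlgebra ℕ G)
    (s : MonoidAlgebra ℕ H) : rangeProj ι (g * MonoidAlgebra.mapDomainRingHom ℕ ι s) =
      rangeProj ι g * s := by
  induction g using MonoidAlgebra.induction_linear with
  | zero => simp
  | add f g hf hg => rw [add_mul, map_add, hf, hg, map_add, add_mul]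
  | single x k =>
    induction s using MonoidAlgebra.induction_linear with
    | zero => simp
    | add f g hf hg => rw [map_add, mul_add, map_add, hf, hg, mul_add]
    | single y l =>
      rw [map_single, MonoidAlgebra.single_mul_single]
      by_cases hx : ∃ z, ι z = x
      · obtain ⟨z, rfl⟩ := hx
        rw [← map_mul, rangeProj_single hι, rangeProj_single hι, MonoidAlgebra.single_mul_single]
      · rw [rangeProj_single_of_notMem hx, zero_mul, rangeProj_single_of_notMem]
        rintro ⟨z, hz⟩
        exact hx ⟨z * y⁻¹, by rw [map_mul, hz, map_inv, mul_inv_cancel_right]⟩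

/-- The linear projection sends each multiple g · ι(s) of a generator to an ℕ[H]-multiple of s,
hence the extended ideal back into I, while it fixes ℕ[H]. -/
theorem comap_map_le {ι : H →* G} (hι : Function.Injective ι) (I : Ideal (MonoidAlgebra ℕ H)) :
    (I.map (MonoidAlgebra.mapDomainRingHom ℕ ι)).comap (MonoidAlgebra.mapDomainRingHom ℕ ι) ≤
      I := by
  -- The claim is made for all multiples g · t because the projection is not multiplicative; it is
  -- then stable under scalar multiplication in the span.
  have key : ∀ t ∈ I.map (MonoidAlgebra.mapDomainRingHom ℕ ι), ∀ g, rangeProj ι (g * t) ∈ I := by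
    intro t ht
    refine Submodule.span_induction ?_ ?_ ?_ ?_ ht
    · rintro _ ⟨s, hs, rfl⟩ g
      rw [rangeProj_mul_map hι]
      exact I.mul_mem_left _ hs
    · intro g
      rw [mul_zero, map_zero]
      exact I.zero_mem
    · intro x y _ _ hx hy g
      rw [mul_add, map_add]
      exact I.add_mem (hx g) (hy g)
    · intro a x _ hx g
      rw [smul_eq_mul, ← mul_assoc]
      exact hx _
  intro s hs
  have := key _ (Ideal.mem_comap.mp hs) (MonoidAlgebra.single (ι 1) 1)
  rwa [rangeProj_mul_map hι, rangeProj_single hι, ← MonoidAlgebra.one_def, one_mul] at this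

/-- An element whose terms lie in one coset of the range of `ι` is in the ideal that is generated
by the elements with terms in the range of `ι`. -/
theorem mem_map_comap_of_homogeneous (ι : H →* G) {N : Ideal (MonoidAlgebra ℕ G)}
    {s : MonoidAlgebra ℕ G} (hs : s ∈ N)
    (h : ∀ u v, s.coeff u ≠ 0 → s.coeff v ≠ 0 → ∃ y, ι y = u⁻¹ * v) :
    s ∈ (N.comap (MonoidAlgebra.mapDomainRingHom ℕ ι)).map
      (MonoidAlgebra.mapDomainRingHom ℕ ι) := by
  by_cases h0 : ∃ u, s.coeff u ≠ 0
  · obtain ⟨u, hu⟩ := h0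
    choose! f hf using fun v => h u v hu
    -- Dividing s by one of its terms u moves all its terms into the range of ι. So s = u · ι(t),
    -- and ι(t) = u⁻¹ · s is again in N.
    let t : MonoidAlgebra ℕ H :=
      ∑ v ∈ s.coeff.support, MonoidAlgebra.single (f v) (s.coeff v)
    have hsum : ∑ v ∈ s.coeff.support, MonoidAlgebra.single v (s.coeff v) = s :=
      MonoidAlgebra.sum_coeff_single s
    have ht : MonoidAlgebra.single u 1 * MonoidAlgebra.mapDomainRingHom ℕ ι t = s := by
      conv_rhs => rw [← hsum]
      rw [map_sum, Finset.mul_sum]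
      refine Finset.sum_congr rfl fun v hv => ?_
      rw [map_single, MonoidAlgebra.single_mul_single, hf v (Finsupp.mem_support_iff.mp hv),
        mul_inv_cancel_left, one_mul]
    rw [← ht]
    refine Ideal.mul_mem_left _ _ (Ideal.mem_map_of_mem _ ?_)
    have : MonoidAlgebra.mapDomainRingHom ℕ ι t = MonoidAlgebra.single u⁻¹ 1 * s := by
      rw [← ht, ← mul_assoc, MonoidAlgebra.single_mul_single, inv_mul_cancel, one_mul,
        ← MonoidAlgebra.one_def, one_mul]
    rw [Ideal.mem_comap, this]
    exact N.mul_mem_left _ hs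
  · push Not at h0
    have : s = 0 := by
      ext u
      simpa using h0 u
    rw [this]
    exact Ideal.zero_mem _

end GroupSemiring

/-! ### Units and null sets of subtracts -/

namespace Subtract

variable {F : Type u} [Tract F] {H : Subgroup Fˣ} {hH : Tract.negOne ∈ H}

theorem incl_units (x : (Subtract F H hH)ˣ) :
    (incl (F := F) (hH := hH)).units x = (unitsEquiv (hH := hH) x : Fˣ) := by
  obtain ⟨y, rfl⟩ := (unitsEquiv (hH := hH)).symm.surjective x
  rfl

theorem incl_units_injective : Function.Injective (incl (F := F) (hH := hH)).units := by
  intro x y hxy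
  rw [incl_units, incl_units] at hxy
  exact unitsEquiv.injective (Subtype.ext hxy)

theorem exists_incl_units {u : Fˣ} (hu : u ∈ H) :
    ∃ x : (Subtract F H hH)ˣ, incl.units x = u :=
  ⟨unitsEquiv.symm ⟨u, hu⟩, by rw [incl_units, MulEquiv.apply_symm_apply]⟩

theorem incl_units_mem (x : (Subtract F H hH)ˣ) : incl.units x ∈ H := by
  rw [incl_units]
  exact Subtype.property _

theorem mem_null_iff_incl (s : MonoidAlgebra ℕ (Subtract F H hH)ˣ) : s ∈ Tract.null ↔
    MonoidAlgebra.mapDomainRingHom ℕ (incl (F := F) (hH := hH)).units s ∈ Tract.null (F := F) := by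
  rw [mem_null_iff, map_congr_hom (g := incl.units) fun x => (incl_units x).symm]

theorem inclusion_units {K : Subgroup Fˣ} {hK : Tract.negOne ∈ K} (h : H ≤ K)
    (x : (Subtract F H hH)ˣ) :
    incl.units ((inclusion (hH := hH) (hK := hK) h).units x) = incl.units x := by
  obtain ⟨y, rfl⟩ := (unitsEquiv (hH := hH)).symm.surjective x
  rfl

end Subtract

/-! ### Gradings and the structure of the universal pasture -/

namespace MConvexSet

variable {n r : ℕ} (J : MConvexSet n r)

theorem deg_unitVar (a : J.Tuples) : J.deg (J.unitVar a) = Multiplicative.ofAdd 1 := by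
  rw [deg, unitVar, TractQuotient.unitsLift_mkUnits, degAux_X]
  simp

theorem multideg_unitVar (a : J.Tuples) :
    J.multideg (J.unitVar a) = Multiplicative.ofAdd (castHom n (content a.1)) := by
  rw [multideg, unitVar, TractQuotient.unitsLift_mkUnits, degAux_X]
  simp

theorem foundationIncl_units (x : J.Foundationˣ) :
    J.univIncl.units (J.foundationIncl.units x) = (Subtract.incl.units x : J.ExtPastureˣ) :=
  Subtract.inclusion_units _ x

theorem foundationIncl_units_injective : Function.Injective J.foundationIncl.units := by
  intro x y hxy
  have := congrArg J.univIncl.units hxy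
  rw [foundationIncl_units, foundationIncl_units] at this
  exact Subtract.incl_units_injective this

theorem deg_univIncl (x : J.UnivPastureˣ) : J.deg (J.univIncl.units x) = 1 :=
  MonoidHom.mem_ker.mp (Subtract.incl_units_mem x)

/-- The multidegree on the universal pasture. -/
noncomputable def univMultideg : J.UnivPastureˣ →* Multiplicative (Fin n → ℤ) :=
  J.multideg.comp J.univIncl.units

theorem univMultideg_eq_one_iff (x : J.UnivPastureˣ) :
    J.univMultideg x = 1 ↔ ∃ a, J.foundationIncl.units a = x := by
  constructor
  · intro h
    obtain ⟨a, ha⟩ := Subtract.exists_incl_units (F := J.ExtPasture)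
      (hH := Subgroup.mem_inf.mpr ⟨J.deg_negOne, J.multideg_negOne⟩)
      (Subgroup.mem_inf.mpr ⟨Subtract.incl_units_mem x, MonoidHom.mem_ker.mpr h⟩)
    refine ⟨a, Subtract.incl_units_injective ?_⟩
    exact (J.foundationIncl_units a).trans ha
  · rintro ⟨a, rfl⟩
    rw [univMultideg, MonoidHom.comp_apply, foundationIncl_units]
    exact MonoidHom.mem_ker.mp (Subgroup.mem_inf.mp (Subtract.incl_units_mem a)).2

/-- The null set of the extended universal pasture is generated by the null set of the
foundation. -/
theorem null_extPasture_le : Tract.null (F := J.ExtPasture) ≤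
    (Tract.null (F := J.Foundation)).map
      (MonoidAlgebra.mapDomainRingHom ℕ (Subtract.incl (F := J.ExtPasture)).units) := by
  have hnull : Tract.null (F := J.Foundation) = (Tract.null (F := J.ExtPasture)).comap
      (MonoidAlgebra.mapDomainRingHom ℕ (Subtract.incl (F := J.ExtPasture)).units) :=
    Ideal.ext fun s => Subtract.mem_null_iff_incl s
  -- For a null element that is homogeneous for both gradings, quotients of two of its terms have
  -- degree and multidegree 0, i.e. they are units of the foundation.
  have hom : ∀ s ∈ Tract.null (F := J.ExtPasture),
      (∃ D, ∀ u, s.coeff u ≠ 0 → (J.deg.prod J.multideg) u = D) →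
      s ∈ (Tract.null (F := J.Foundation)).map
        (MonoidAlgebra.mapDomainRingHom ℕ (Subtract.incl (F := J.ExtPasture)).units) := by
    rintro s hs ⟨D, hD⟩
    rw [hnull]
    refine mem_map_comap_of_homogeneous _ hs fun u v hu hv => Subtract.exists_incl_units ?_
    have := (hD u hu).trans (hD v hv).symm
    rw [MonoidHom.prod_apply, MonoidHom.prod_apply, Prod.mk.injEq] at this
    rw [Subgroup.mem_inf, MonoidHom.mem_ker, MonoidHom.mem_ker, map_mul, map_mul, map_inv,
      map_inv, this.1, this.2]
    simp
  have hneg : (J.deg.prod J.multideg) Tract.negOne = 1 :=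
    Prod.ext (MonoidHom.mem_ker.mp J.deg_negOne) (MonoidHom.mem_ker.mp J.multideg_negOne)
  -- The bidegree of x_b is split into a constant part and a character of Σb, as the homogeneity
  -- lemmas for the relations require.
  have hrep : ∀ b (u : J.ExtPastureˣ), J.univRep b = u → (J.deg.prod J.multideg) u =
      (Multiplicative.ofAdd 1, 1) * (MonoidHom.prod 1 (castHom n).toMultiplicative)
        (Multiplicative.ofAdd (content b)) := by
    intro b u hu
    by_cases hb : content b ∈ J.reduction
    · rw [J.univRep_tuple ⟨b, hb⟩] at hu
      rw [← Units.ext hu, MonoidHom.prod_apply, deg_unitVar, multideg_unitVar]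
      simp
    · rw [J.univRep_eq_zero hb] at hu
      exact absurd hu.symm u.ne_zero
  rw [TractQuotient.null_eq_span, Ideal.span_le]
  rintro _ ⟨s, hs | hs, rfl⟩
  · rw [SetLike.mem_coe, ← Ideal.mem_comap]
    -- The null set of the free algebra is generated by 1 + (-1), which is homogeneous of bidegree
    -- 0.
    refine FreeAlgebra.null_le_of_const TractQuotient.mkUnits
      (RegularPartialField.null_le _ ?_) hs
    rw [MonoidHom.comp_apply, TractHom.units_negOne, TractQuotient.mkUnits_negOne]
    refine hom _ ((Tract.single_mem_iff _ _).mpr (mul_one _).symm) ⟨1, fun u hu => ?_⟩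
    have hu' : 1 = u ∨ Tract.negOne = u := by
      classical
      by_contra hcon
      push Not at hcon
      simp [MonoidAlgebra.coeff_single, hcon] at hu
    rcases hu' with rfl | rfl
    · exact map_one _
    · exact hneg
  · have hmem : MonoidAlgebra.mapDomainRingHom ℕ (TractQuotient.mkUnits
        (hS := J.single_notMem_relations)) s ∈ Tract.null (F := J.ExtPasture) := by
      rw [TractQuotient.null_eq_span]
      exact Ideal.subset_span ⟨s, Or.inr hs, rfl⟩
    have hvar : ∀ a, TractQuotient.mkHom J.single_notMem_relations (J.var a) = J.univRep a :=
      fun a => TractQuotient.mkHom_apply _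
    rcases hs with ⟨m, h, a, i, j, k, l, -, rfl⟩ | ⟨a, σ, rfl⟩
    · rw [← TractQuotient.mkHom_units, TractHom.map_plucker₃] at hmem ⊢
      simp only [hvar] at hmem ⊢
      exact hom _ hmem ⟨_, J.plucker₃_homogeneous _ hneg _ _ _ hrep h a i j k l⟩
    · rw [← TractQuotient.mkHom_units, map_add, TractHom.map_formal, TractHom.map_formal,
        TractHom.apply_mul, Units.val_mul, TractHom.apply_mul, TractHom.map_negOne,
        TractHom.map_signIn, hvar, hvar, ← Units.val_mul] at hmem ⊢
      exact hom _ hmem ⟨_, J.alternating_homogeneous _ hneg _ _ _ hrep a σ⟩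

/-- A null sum of the universal pasture is null in the extended pasture, hence in the ideal
generated there by the null set of the foundation. As the inclusion of units is injective,
`comap_map_le` contracts this ideal to the one generated in the smaller group semiring. -/
theorem null_univPasture_le : Tract.null (F := J.UnivPasture) ≤
    (Tract.null (F := J.Foundation)).map
      (MonoidAlgebra.mapDomainRingHom ℕ J.foundationIncl.units) := by
  intro s hs
  refine comap_map_le (Subtract.incl_units_injective (F := J.ExtPasture) (H := J.deg.ker)
    (hH := J.deg_negOne)) _ (Ideal.mem_comap.mpr ?_)
  have := J.null_extPasture_le ((Subtract.mem_null_iff_incl s).mp hs)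
  rw [Ideal.map_map, ← MonoidAlgebra.mapDomainRingHom_comp]
  rwa [← show J.univIncl.units.comp J.foundationIncl.units = Subtract.incl.units from
    MonoidHom.ext J.foundationIncl_units] at this

/-- The character of the unit group of the extended universal pasture with weight the multidegree
that is defined by a point of the torus. -/
noncomputable def torusChar {A : Type*} [CommGroup A] (t : Fin n → A) : J.ExtPastureˣ →* A where
  toFun u := ∏ i, t i ^ (J.multideg u).toAdd i
  map_one' := by simp
  map_mul' u v := by simp [zpow_add, Finset.prod_mul_distrib]

theorem torusChar_apply {A : Type*} [CommGroup A] (t : Fin n → A) (u : J.ExtPastureˣ) :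
    J.torusChar t u = ∏ i, t i ^ (J.multideg u).toAdd i := rfl

theorem torusChar_unitVar {A : Type*} [CommGroup A] (t : Fin n → A) (a : J.Tuples) :
    J.torusChar t (J.unitVar a) = monomial t (content a.1) := by
  rw [torusChar_apply, multideg_unitVar]
  simp [castHom, monomial]

theorem torusChar_negOne {A : Type*} [CommGroup A] (t : Fin n → A) :
    J.torusChar t Tract.negOne = 1 := by
  rw [torusChar_apply, MonoidHom.mem_ker.mp J.multideg_negOne]
  simp

/-- The character defined by a point of the torus that is constant on the components of `J` is
trivial on the universal pasture. -/
theorem torusChar_univIncl {A : Type*} [CommGroup A] {t : Fin n → A}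
    (ht : ∀ i j, connSetoid J.carrier i j → t i = t j) (x : J.UnivPastureˣ) :
    J.torusChar t (J.univIncl.units x) = 1 := by
  let c := monomial t (content (Classical.arbitrary J.Tuples).1)
  -- Such a character has the same value c at every x_a, so it is u ↦ c^{deg u} and is trivial in
  -- degree 0.
  have : J.torusChar t = (zpowersHom A c).comp J.deg := by
    refine J.extPasture_hom_ext ?_ fun a => ?_
    · rw [torusChar_negOne, MonoidHom.comp_apply, MonoidHom.mem_ker.mp J.deg_negOne, map_one]
    · rw [torusChar_unitVar, MonoidHom.comp_apply, deg_unitVar,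
        (J.monomial_content_eq_iff t).mpr ht a (Classical.arbitrary J.Tuples)]
      simp [c]
  rw [this, MonoidHom.comp_apply, deg_univIncl, map_one]

/-- If Σa + ε_i = Σb + ε_j, then x_b / x_a has degree 0 and multidegree ε_i - ε_j. Products and
inverses extend this from adjacent to connected pairs. -/
theorem exists_univMultideg_eq {i j : Fin n} (h : connSetoid J.carrier i j) :
    ∃ x, J.univMultideg x = Multiplicative.ofAdd (Pi.single i 1 - Pi.single j 1) := by
  induction h with
  | rel i j h =>
    obtain ⟨a, b, e⟩ := J.exists_tuples_of_adjacent h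
    obtain ⟨x, hx⟩ := Subtract.exists_incl_units (hH := J.deg_negOne)
      (u := J.unitVar b / J.unitVar a) (MonoidHom.mem_ker.mpr (by
        rw [map_div, deg_unitVar, deg_unitVar, div_self']))
    refine ⟨x, ?_⟩
    rw [univMultideg, MonoidHom.comp_apply, univIncl, hx, map_div, multideg_unitVar,
      multideg_unitVar, ← ofAdd_sub]
    congr 1
    funext y
    have := congrFun e y
    simp only [castHom, basisVec, Pi.add_apply, Pi.sub_apply, Pi.single_apply,
      AddMonoidHom.coe_mk, ZeroHom.coe_mk] at this ⊢
    split_ifs at this ⊢ <;> omega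
  | refl i => exact ⟨1, by simp⟩
  | symm i j _ ih =>
    obtain ⟨x, hx⟩ := ih
    exact ⟨x⁻¹, by rw [map_inv, hx, ← ofAdd_neg, neg_sub]⟩
  | trans i j k _ _ ih₁ ih₂ =>
    obtain ⟨x, hx⟩ := ih₁
    obtain ⟨y, hy⟩ := ih₂
    exact ⟨x * y, by rw [map_mul, hx, hy, ← ofAdd_add, sub_add_sub_cancel]⟩

/-- An element of the universal pasture of multidegree `ε_i - ε_{rep i}`, where `i` is the `k`-th
element that is not a chosen representative. -/
noncomputable def freeGen (k : Fin (n - J.numComponents)) : J.UnivPastureˣ :=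
  (J.exists_univMultideg_eq ((connSetoid J.carrier).symm (J.conn_rep (J.nonrep k).1))).choose

theorem univMultideg_freeGen (k : Fin (n - J.numComponents)) :
    J.univMultideg (J.freeGen k) = Multiplicative.ofAdd
      (Pi.single (J.nonrep k).1 1 - Pi.single (J.rep (J.nonrep k).1) 1) :=
  (J.exists_univMultideg_eq ((connSetoid J.carrier).symm (J.conn_rep (J.nonrep k).1))).choose_spec

theorem prod_zpow_single {A : Type*} [CommGroup A] (t : Fin n → A) (i : Fin n) :
    ∏ j, t j ^ (Pi.single i 1 : Fin n → ℤ) j = t i := by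
  rw [Finset.prod_eq_single i]
  · simp
  · intro j _ hj
    simp [hj]
  · simp

/-- Only the multidegree ε_i - ε_{rep i} of the chosen generator matters, and it is the weight of
the corresponding coordinate of `torusHom`. This links the free generators to the torus action. -/
theorem torusChar_freeGen {A : Type*} [CommGroup A] (t : Fin n → A)
    (k : Fin (n - J.numComponents)) :
    J.torusChar t (J.univIncl.units (J.freeGen k)) = J.torusHom A t k := by
  have h : J.multideg (J.univIncl.units (J.freeGen k)) = _ := J.univMultideg_freeGen k
  simp only [torusChar_apply, h, torusHom_apply, toAdd_ofAdd, Pi.sub_apply, zpow_sub,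
    Finset.prod_mul_distrib, Finset.prod_inv_distrib, prod_zpow_single, div_eq_mul_inv]

/-- The multidegrees at the elements that are not chosen representatives. -/
noncomputable def nonrepDeg :
    J.UnivPastureˣ →* Multiplicative (Fin (n - J.numComponents) →₀ ℤ) where
  toFun x := Multiplicative.ofAdd
    (Finsupp.equivFunOnFinite.symm fun k => (J.univMultideg x).toAdd (J.nonrep k).1)
  map_one' := by
    rw [map_one]
    exact Multiplicative.toAdd.injective (Finsupp.ext fun _ => rfl)
  map_mul' x y := by
    rw [map_mul]
    exact Multiplicative.toAdd.injective (Finsupp.ext fun _ => rfl)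

theorem nonrepDeg_apply (x : J.UnivPastureˣ) (k) :
    (J.nonrepDeg x).toAdd k = (J.univMultideg x).toAdd (J.nonrep k).1 := rfl

/-- The term -ε_{rep i} of the multidegree is invisible at non-representatives. -/
theorem nonrepDeg_freeGen (k : Fin (n - J.numComponents)) :
    J.nonrepDeg (J.freeGen k) = Multiplicative.ofAdd (Finsupp.single k 1) := by
  refine Multiplicative.toAdd.injective (Finsupp.ext fun l => ?_)
  rw [nonrepDeg_apply, univMultideg_freeGen]
  have h₁ : (J.nonrep l).1 ≠ J.rep (J.nonrep k).1 := by
    intro h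
    apply (J.nonrep l).2
    rw [h, rep_rep]
  have h₂ : (J.nonrep l).1 = (J.nonrep k).1 ↔ k = l := by
    rw [← Subtype.ext_iff, J.nonrep.injective.eq_iff, eq_comm]
  simp [Pi.single_apply, Finsupp.single_apply, h₁, h₂]

/-- The multidegree sums to zero over each component, so the entry at its representative is
determined by the other entries. -/
theorem univMultideg_eq_one_of_nonrepDeg {x : J.UnivPastureˣ} (h : J.nonrepDeg x = 1) :
    J.univMultideg x = 1 := by
  have hv : ∀ i, J.rep i ≠ i → (J.univMultideg x).toAdd i = 0 := by
    intro i hi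
    have := J.nonrepDeg_apply x (J.nonrep.symm ⟨i, hi⟩)
    rw [h, Equiv.apply_symm_apply] at this
    exact this.symm
  refine Multiplicative.toAdd.injective (funext fun i => ?_)
  by_cases hi : J.rep i = i
  -- With the generator of ℤ on the component of i and the neutral element elsewhere, the character
  -- of t is the sum of the multidegree over that component.
  · let t : Fin n → Multiplicative ℤ := fun j =>
      if J.rep j = i then Multiplicative.ofAdd 1 else 1
    have ht := J.torusChar_univIncl (t := t) (fun j k hjk => by
      simp only [t, J.rep_eq_iff.mpr hjk]) x
    rw [torusChar_apply, Finset.prod_eq_single i] at ht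
    · rw [show t i = Multiplicative.ofAdd 1 from if_pos hi, ← ofAdd_zsmul] at ht
      change (J.multideg (J.univIncl.units x)).toAdd i = 0
      simpa using ht
    · intro j _ hj
      by_cases hji : J.rep j = i
      · have : (J.multideg (J.univIncl.units x)).toAdd j = 0 := hv j (by
          rw [hji]
          exact hj.symm)
        rw [this, zpow_zero]
      · rw [show t j = 1 from if_neg hji, one_zpow]
    · simp
  · exact hv i hi

/-- The homomorphism of unit groups from the free algebra over the foundation to the universal
pasture. -/
noncomputable def freeUnitsHom :
    (FreeAlgebra J.Foundation (Fin (n - J.numComponents)))ˣ →* J.UnivPastureˣ :=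
  FreeAlgebra.unitsLift J.foundationIncl.units J.freeGen

/-- Coefficients from the foundation have multidegree 0 and the generators map to basis vectors.
Thus `nonrepDeg` reads off exponents and splits the unit group of the universal pasture. -/
theorem nonrepDeg_freeUnitsHom (u : (FreeAlgebra J.Foundation (Fin (n - J.numComponents)))ˣ) :
    J.nonrepDeg (J.freeUnitsHom u) = FreeAlgebra.exponents u := by
  refine DFunLike.congr_fun (f := J.nonrepDeg.comp J.freeUnitsHom)
    (FreeAlgebra.hom_ext (fun a => ?_) fun k => ?_) u
  · rw [MonoidHom.comp_apply, freeUnitsHom, FreeAlgebra.unitsLift_const]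
    refine Multiplicative.toAdd.injective (Finsupp.ext fun k => ?_)
    rw [nonrepDeg_apply, (J.univMultideg_eq_one_iff _).mpr ⟨a, rfl⟩, FreeAlgebra.units_const]
    rfl
  · rw [MonoidHom.comp_apply, freeUnitsHom, FreeAlgebra.unitsLift_X, nonrepDeg_freeGen]
    rfl

theorem freeUnitsHom_bijective : Function.Bijective J.freeUnitsHom := by
  constructor
  · rw [injective_iff_map_eq_one]
    intro u hu
    have h := J.nonrepDeg_freeUnitsHom u
    rw [hu, map_one] at h
    obtain ⟨⟨a, e⟩, rfl⟩ := FreeAlgebra.unitsEquiv.symm.surjective u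
    have he : e = 1 := h.symm
    subst he
    rw [← FreeAlgebra.units_const, freeUnitsHom, FreeAlgebra.unitsLift_const,
      ← map_one J.foundationIncl.units] at hu
    rw [J.foundationIncl_units_injective hu]
    exact map_one FreeAlgebra.unitsEquiv.symm
  · intro x
    let u : (FreeAlgebra J.Foundation (Fin (n - J.numComponents)))ˣ :=
      FreeAlgebra.unitsEquiv.symm (1, J.nonrepDeg x)
    have hu : J.nonrepDeg (J.freeUnitsHom u) = J.nonrepDeg x := J.nonrepDeg_freeUnitsHom u
    obtain ⟨a, ha⟩ := (J.univMultideg_eq_one_iff (x / J.freeUnitsHom u)).mp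
      (J.univMultideg_eq_one_of_nonrepDeg (by rw [map_div, hu, div_self']))
    refine ⟨FreeAlgebra.const.units a * u, ?_⟩
    rw [map_mul]
    conv_lhs =>
      arg 1
      rw [freeUnitsHom, FreeAlgebra.unitsLift_const, ha]
    rw [div_mul_cancel]

/-- The unit group of the universal pasture. -/
noncomputable def freeUnitsEquiv :
    (FreeAlgebra J.Foundation (Fin (n - J.numComponents)))ˣ ≃* J.UnivPastureˣ :=
  MulEquiv.ofBijective J.freeUnitsHom J.freeUnitsHom_bijective

theorem freeUnitsEquiv_const (a : J.Foundationˣ) :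
    J.freeUnitsEquiv (FreeAlgebra.const.units a) = J.foundationIncl.units a :=
  FreeAlgebra.unitsLift_const _ _ a

theorem freeUnitsEquiv_X (k : Fin (n - J.numComponents)) :
    J.freeUnitsEquiv (FreeAlgebra.X k) = J.freeGen k :=
  FreeAlgebra.unitsLift_X _ _ k

/-- The universal pasture is a free algebra over the foundation. -/
noncomputable def univPastureIso :
    TractIso (FreeAlgebra J.Foundation (Fin (n - J.numComponents))) J.UnivPasture :=
  TractIso.ofUnits J.freeUnitsEquiv fun s => by
    constructor
    · intro hs
      rw [← Ideal.mem_comap]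
      refine FreeAlgebra.null_le_of_const J.freeUnitsEquiv.toMonoidHom ?_ hs
      rw [show J.freeUnitsEquiv.toMonoidHom.comp FreeAlgebra.const.units = J.foundationIncl.units
        from MonoidHom.ext J.freeUnitsEquiv_const]
      exact J.foundationIncl.null_le
    · intro hs
      -- The null set of the universal pasture is generated over the foundation, and the inverse
      -- isomorphism of units carries the foundation to the constants of the free algebra.
      have key : (Tract.null (F := J.Foundation)).map
          (MonoidAlgebra.mapDomainRingHom ℕ J.foundationIncl.units) ≤
          (Tract.null (F := FreeAlgebra J.Foundation (Fin (n - J.numComponents)))).comap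
            (MonoidAlgebra.mapDomainRingHom ℕ J.freeUnitsEquiv.symm.toMonoidHom) := by
        rw [Ideal.map_le_iff_le_comap]
        intro t ht
        rw [Ideal.mem_comap, Ideal.mem_comap, map_map, map_congr_hom
          (f := J.freeUnitsEquiv.symm.toMonoidHom.comp J.foundationIncl.units)
          (g := FreeAlgebra.const.units) fun a => by
            rw [← J.freeUnitsEquiv.symm_apply_apply (FreeAlgebra.const.units a),
              freeUnitsEquiv_const]
            rfl]
        exact FreeAlgebra.const.null_le ht
      have := key (J.null_univPasture_le hs)
      rwa [Ideal.mem_comap, map_map, map_eq_self fun u => J.freeUnitsEquiv.symm_apply_apply u]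
        at this

theorem univPastureIso_const (a : J.Foundation) :
    J.univPastureIso.hom (FreeAlgebra.const a) = J.foundationIncl a := by
  by_cases ha : a = 0
  · rw [ha, TractHom.apply_zero, TractHom.apply_zero, TractHom.apply_zero]
  · lift a to J.Foundationˣ using IsUnit.mk0 a ha
    rw [← TractHom.coe_units FreeAlgebra.const, ← TractHom.coe_units J.foundationIncl,
      univPastureIso, TractIso.ofUnits, TractHom.ofUnits_coe]
    exact congrArg Units.val (J.freeUnitsEquiv_const a)

theorem univPastureIso_X (k : Fin (n - J.numComponents)) :
    J.univPastureIso.hom ((FreeAlgebra.X k : (FreeAlgebra J.Foundation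
      (Fin (n - J.numComponents)))ˣ) : FreeAlgebra J.Foundation _) = J.freeGen k := by
  rw [univPastureIso, TractIso.ofUnits, TractHom.ofUnits_coe]
  exact congrArg Units.val (J.freeUnitsEquiv_X k)

end MConvexSet

/-! ### Coordinates on the thin Schubert cell -/

section Coordinates

variable {n r : ℕ} {J : MConvexSet n r} {F : Type u} [Tract F] {F₂ : Type v} [Tract F₂]

/-- Both sides are homomorphisms in u with value s t^{Σa} ρ(a) at x_a for p = (s, t), and they agree
at -1, which has degree and multidegree 0. -/
theorem WeakRep.toHom_smul_units (p : Fˣ × (Fin n → Fˣ)) (ρ : WeakRep J F) (u : J.ExtPastureˣ) :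
    (p • ρ).toHom.units u =
      p.1 ^ (J.deg u).toAdd * J.torusChar p.2 u * ρ.toHom.units u := by
  refine DFunLike.congr_fun
    (g := ((zpowersHom Fˣ p.1).comp J.deg * J.torusChar p.2) * ρ.toHom.units)
    (J.extPasture_hom_ext ?_ fun a => ?_) u
  · simp [TractHom.units_negOne, MonoidHom.mem_ker.mp J.deg_negOne, J.torusChar_negOne]
  · simp only [MonoidHom.mul_apply, MonoidHom.comp_apply, WeakRep.toHom_units_unitVar,
      J.deg_unitVar, J.torusChar_unitVar]
    refine Units.ext ?_
    change (p • ρ) a.1 = _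
    rw [WeakRep.smul_apply, WeakRep.weight_eq]
    simp [WeakRep.unit]

/-- The values at the free generators of the universal pasture of the morphism that corresponds
to a weak representation. -/
noncomputable def WeakRep.coordinates (ρ : WeakRep J F) : Fin (n - J.numComponents) → Fˣ :=
  fun k => ρ.toHom.units (J.univIncl.units (J.freeGen k))

/-- The generators have degree 0, so scalars drop out, and their multidegrees are the weights of
`torusHom`. -/
theorem WeakRep.coordinates_smul (p : Fˣ × (Fin n → Fˣ)) (ρ : WeakRep J F) :
    (p • ρ).coordinates = J.torusHom Fˣ p.2 * ρ.coordinates := by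
  funext k
  rw [WeakRep.coordinates, WeakRep.toHom_smul_units, J.deg_univIncl, J.torusChar_freeGen]
  simp [WeakRep.coordinates]

/-- The map from the thin Schubert cell to the product of the realization space with a torus. -/
noncomputable def Gr.split : Gr J F → RealizationSpace J F × (Fin (n - J.numComponents) → Fˣ) :=
  Quotient.lift (fun ρ : WeakRep J F => (RealizationSpace.mk ρ, ρ.coordinates)) (by
    rintro _ ρ ⟨c, rfl⟩
    have h : c • ρ = ((c, 1) : Fˣ × (Fin n → Fˣ)) • ρ := rfl
    refine Prod.ext (RealizationSpace.mk_eq_iff.mpr ⟨(c, 1), h.symm⟩) ?_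
    dsimp only
    rw [h, WeakRep.coordinates_smul, map_one, one_mul])

theorem Gr.split_mk (ρ : WeakRep J F) :
    Gr.split (Gr.mk ρ) = (RealizationSpace.mk ρ, ρ.coordinates) := rfl

/-- The fibre over a point of the realization space is a torus orbit, on which t multiplies the
coordinates by `torusHom` of t. The kernel of `torusHom` is the stabilizer, which gives injectivity,
and its surjectivity gives all coordinates. -/
theorem Gr.split_bijective : Function.Bijective (Gr.split (J := J) (F := F)) := by
  constructor
  · rintro ⟨ρ⟩ ⟨ρ'⟩ h
    obtain ⟨h₁, h₂⟩ := Prod.mk.inj h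
    obtain ⟨p, rfl⟩ := RealizationSpace.mk_eq_iff.mp h₁
    rw [WeakRep.coordinates_smul, mul_eq_right] at h₂
    have hp := (Gr.smul_eq_iff (Gr.mk ρ') p.2).mpr h₂
    change Gr.mk _ = Gr.mk _
    rw [← hp, Gr.smul_mk, WeakRep.prod_smul]
    exact Gr.mk_eq_iff.mpr ⟨p.1, rfl⟩
  · rintro ⟨⟨ρ⟩, s⟩
    obtain ⟨t, ht⟩ := J.torusHom_surjective Fˣ (s / ρ.coordinates)
    refine ⟨Gr.mk (((1, t) : Fˣ × (Fin n → Fˣ)) • ρ), Prod.ext ?_ ?_⟩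
    · exact RealizationSpace.mk_eq_iff.mpr ⟨(1, t), rfl⟩
    · rw [Gr.split_mk]
      dsimp only
      rw [WeakRep.coordinates_smul, ht, div_mul_cancel]

theorem WeakRep.coordinates_map (f : TractHom F F₂) (ρ : WeakRep J F) :
    (ρ.map f).coordinates = fun k => f.units (ρ.coordinates k) := by
  funext k
  rw [WeakRep.coordinates, WeakRep.toHom_map]
  rfl

theorem Gr.split_map (f : TractHom F F₂) (x : Gr J F) :
    Gr.split (Gr.map f x) =
      (RealizationSpace.map f (Gr.split x).1, fun k => f.units ((Gr.split x).2 k)) := by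
  obtain ⟨ρ, rfl⟩ : ∃ ρ, Gr.mk ρ = x := Quotient.exists_rep x
  exact Prod.ext rfl (WeakRep.coordinates_map f ρ)

end Coordinates

end PolyTract

/-! ### The theorem -/

open PolyTract in
theorem theoremM {n r : ℕ} (J : MConvexSet n r) :
    -- decompositions into indecomposable components exist, and all of them have `c(J)` components
    ((∃ κ : Fin n → Fin J.numComponents, IsIndecomposableDecomposition J.carrier κ) ∧
      ∀ (m : ℕ) (κ : Fin n → Fin m), IsIndecomposableDecomposition J.carrier κ →
        m = J.numComponents) ∧
    -- the stabilizer of a class consists of the `t` that are constant on each component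
    (∀ (m : ℕ) (κ : Fin n → Fin m), IsIndecomposableDecomposition J.carrier κ →
      ∀ (F : Type u) [Tract F] (x : Gr J F) (t : Fin n → Fˣ),
        t ∈ MulAction.stabilizer (Fin n → Fˣ) x ↔ ∀ i j, κ i = κ j → t i = t j) ∧
    -- each orbit is in bijection with `(Fˣ) ^ (n - c(J))`, compatibly with the torus action
    (∀ (F : Type u) [Tract F] (x : Gr J F),
      ∃ (φ : (Fin n → Fˣ) →* (Fin (n - J.numComponents) → Fˣ))
        (e : MulAction.orbit (Fin n → Fˣ) x ≃ (Fin (n - J.numComponents) → Fˣ)),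
        ∀ t : Fin n → Fˣ, e ⟨t • x, MulAction.mem_orbit x t⟩ = φ t) ∧
    -- weak representations are the same as morphisms from the extended universal pasture
    (∀ (F : Type u) [Tract F] (ρ : WeakRep J F),
      ∃! f : TractHom J.ExtPasture F, ∀ a, f (J.univRep a) = ρ a) ∧
    -- the universal pasture is a free algebra over the foundation, and the images of the free
    -- generators define the bijection between the cell and the product, functorially
    (∃ Φ : TractIso (FreeAlgebra J.Foundation (Fin (n - J.numComponents))) J.UnivPasture,
      (∀ a : J.Foundation, Φ.hom (FreeAlgebra.const a) = J.foundationIncl a) ∧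
      ∃ Ψ : ∀ (F : Type u) [Tract F],
          Gr J F ≃ RealizationSpace J F × (Fin (n - J.numComponents) → Fˣ),
        (∀ (F : Type u) [Tract F] (ρ : WeakRep J F) (f : TractHom J.ExtPasture F),
          (∀ a, f (J.univRep a) = ρ a) →
            (Ψ F (Gr.mk ρ)).1 = RealizationSpace.mk ρ ∧
            ∀ i, ((Ψ F (Gr.mk ρ)).2 i : F) =
              f (J.univIncl (Φ.hom ((FreeAlgebra.X i : (FreeAlgebra J.Foundation
                (Fin (n - J.numComponents)))ˣ) : FreeAlgebra J.Foundation _)))) ∧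
        ∀ (F₁ F₂ : Type u) [Tract F₁] [Tract F₂] (f : TractHom F₁ F₂) (x : Gr J F₁),
          Ψ F₂ (Gr.map f x) =
            (RealizationSpace.map f (Ψ F₁ x).1, fun i => f.units ((Ψ F₁ x).2 i))) ∧
    -- the lineality space is a torus of rank `n - c(J)`
    (∀ (F : Type u) [Tract F] (hF : IsIdempotent F),
      ∃ e : lineality J hF ≃ (Fin (n - J.numComponents) → Fˣ),
        ∀ (ρ₁ ρ₂ ρ₃ : WeakRep J F) (h₁ : Gr.mk ρ₁ ∈ lineality J hF)
          (h₂ : Gr.mk ρ₂ ∈ lineality J hF) (h₃ : Gr.mk ρ₃ ∈ lineality J hF),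
          (∀ a, ρ₃ a = ρ₁ a * ρ₂ a) → e ⟨_, h₃⟩ = e ⟨_, h₁⟩ * e ⟨_, h₂⟩) := by
  have hcard := J.numComponents_eq_card
  refine ⟨⟨?_, fun m κ hκ => ?_⟩, fun m κ hκ F _ x t => ?_, fun F _ x => ?_, fun F _ ρ => ?_,
    ⟨J.univPastureIso, J.univPastureIso_const, fun F _ => Equiv.ofBijective _ Gr.split_bijective,
      fun F _ ρ f hf => ⟨rfl, fun k => ?_⟩, fun F₁ F₂ _ _ f x => Gr.split_map f x⟩,
    fun F _ hF => exists_linealityEquiv hF⟩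
  · rw [hcard]
    exact J.isMConvex.exists_decomposition
  · rw [hcard]
    exact J.isMConvex.card_eq_of_decomposition hκ
  · rw [MulAction.mem_stabilizer_iff, Gr.smul_eq_iff, J.torusHom_eq_one_iff]
    simp only [(J.isMConvex.isIndecomposableDecomposition_iff.mp hκ).2]
  · exact ⟨J.torusHom Fˣ, Gr.exists_orbitEquiv x⟩
  · exact ⟨ρ.toHom, ρ.toHom_univRep, fun f hf => ρ.eq_toHom hf⟩
  · rw [ρ.eq_toHom hf, J.univPastureIso_X]
    rfl
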